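/- All logarithms are in base $2$. An implicit set problem $\mathcal P$ is a set of instances $(E,\mathcal F,B,\mathsf{oracle})$, where $E$ is a finite set (its elements being represented by bit strings), $\mathcal F\subseteq 2^E$, $B\in\{0,1\}^*$ is the encoding of the instance, and $\mathsf{oracle}:2^E\times\mathbb N\to\{0,1\}$. Algorithms are (multi-tape) oracle Turing machines that receive $B$ as input and have access to $\mathsf{oracle}$; randomized algorithms may in addition use fair random bits, and running-time bounds hold for all outcomes of the random bits. We assume that $\mathcal P$ is polynomial time computable: there are deterministic algorithms which, for every instance, compute $E$ from $B$, and decide whether $S\in\mathcal F$ from $B$ and $S\subseteq E$, in time $\mathrm{poly}(|B|)$. For $X\subseteq E$ and $\ell\in\mathbb N$, a set $S\subseteq E\setminus X$ is an $\ell$-extension of $X$ if $|S|=\ell$ and $X\cup S\in\mathcal F$. For $g:\mathbb N\to\mathbb N$, a random extension algorithm for $\mathcal P$ of time $g$ is a randomized algorithm which, given $B$, $X\subseteq E$ and $\ell\in\mathbb N$ (in binary), runs in time $g(\ell)\cdot\mathrm{poly}(|B|)$, always returns either $\perp$ or an $\ell$-extension of $X$, and returns an $\ell$-extension of $X$ with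 probability at least $1/2$ if there is one. A randomized algorithm for $\mathcal P$ always answers "yes" or "no"; it answers "yes" with probability at least $1/2$ if $\mathcal F\neq\emptyset$, and "no" with probability $1$ if $\mathcal F=\emptyset$. For $g:\mathbb N\to\mathbb N$ put $$\Phi_g(n)=\max\Big\{\ell\cdot\log\Big(\frac{n}{4\ell}\Big)-\log g(\ell)\ :\ \ell\in\mathbb N,\ 0\le\ell\le n/4\Big\},$$ where the first term is $0$ for $\ell=0$. For $f:\mathbb N\to\mathbb R$, "$f(n)=\Omega(\log^2 n)$" means that there is $c>0$ with $f(n)\ge c\log^2 n$ for all sufficiently large $n$. **Lemma.** Let $\alpha>0$ and $g(\ell)=\lfloor 2^{\alpha\ell^2}\rfloor$. Then: 1. $\Phi_g(n)=\Omega(\log^2 n)$. 2. There is a function $f:\mathbb N\to\mathbb R$ with $f(n)=\Omega(\log^2 n)$ (depending only on $\alpha$) such that every polynomial time computable implicit set problem $\mathcal P$ which has a random extension algorithm of time $g$ has a randomized algorithm which runs in time $2^{|E|-f(|E|)}\cdot\mathrm{poly}(|B|)$ on every instance $(E,\mathcal F,B,\mathsf{oracle})\in\mathcal P$. That is, $\mathcal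 P$ has a randomized algorithm of running time $2^{|E|-\Omega(\log^2|E|)}\cdot\mathrm{poly}(|B|)$. -/

import Mathlib

/-! ### Words over the fixed input/output alphabet -/

/-- The alphabet in which inputs, outputs and oracle queries are written: the two bits, two
separators and the symbol `bot` that stands for the answer `⊥`. -/
inductive Letter : Type
  | bit (b : Bool)
  | comma
  | hash
  | bot

abbrev Word : Type := List Letter

/-- A bit string as a word. -/
def bitsWord (B : List Bool) : Word := B.map Letter.bit

/-- A natural number as a word, in binary. -/
def natWord (n : ℕ) : Word := bitsWord (Computability.encodeNat n)

/-- The elements of ground sets, in the form in which machines handle them: each element is (named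
by) a bit string. -/
abbrev Elt : Type := List Bool

/-- A list of elements as a word; every name is followed by a comma. -/
def listWord (l : List Elt) : Word := l.flatMap (fun e => bitsWord e ++ [Letter.comma])

/-- `w` represents the finite set `S`: it lists the elements of `S`, in some order, without
repetition. -/
def IsSetWord (w : Word) (S : Finset Elt) : Prop :=
  ∃ l : List Elt, l.Nodup ∧ l.toFinset = S ∧ w = listWord l

/-! ### Randomized oracle Turing machines -/

/-- A randomized multi-tape oracle Turing machine. It has finitely many two-way infinite tapes, a
finite tape alphabet (whose blank symbol is `default`) that contains the symbols of `Letter`, and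
finitely many states. In every ordinary step the machine sees the symbols under the heads and one
fresh fair random bit, changes its state, writes one symbol on every tape, and then moves every head
by at most one cell. In the state `ask` the oracle is consulted about the word on the query tape;
the next state is `yes` or `no`, according to the answer. -/
structure OracleMachine : Type 1 where
  Tp : Type
  State : Type
  Γ : Type
  [tpFintype : Fintype Tp]
  [tpDecEq : DecidableEq Tp]
  [stateFintype : Fintype State]
  [stateDecEq : DecidableEq State]
  [symbolFintype : Fintype Γ]
  [symbolInhabited : Inhabited Γ]
  sym : Letter → Γ
  sym_injective : Function.Injective sym
  sym_ne_blank : ∀ a, sym a ≠ default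
  inputTape : Tp
  outputTape : Tp
  queryTape : Tp
  start : State
  halt : State
  ask : State
  yes : State
  no : State
  δ : State → (Tp → Γ) → Bool → State × (Tp → Γ × Option Turing.Dir)

namespace OracleMachine

attribute [instance] tpFintype tpDecEq stateFintype stateDecEq symbolFintype symbolInhabited

/-- A configuration: the state, and the tapes together with their head positions. -/
structure Cfg (M : OracleMachine) : Type where
  state : M.State
  tape : M.Tp → Turing.Tape M.Γ

/-- The tape `t` shows the word `w`: the symbols of `w` stand in the cells from the head onwards to
the right, and the next cell is blank. -/
def Shows (M : OracleMachine) (t : Turing.Tape M.Γ) (w : Word) : Prop :=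
  (∀ (i : ℕ) (h : i < w.length), t.nth i = M.sym w[i]) ∧ t.nth w.length = default

/-- The initial configuration: the input tape carries `w`, with its head on the first symbol, and all
other tapes are blank. -/
def init (M : OracleMachine) (w : Word) : M.Cfg where
  state := M.start
  tape := fun i => if i = M.inputTape then Turing.Tape.mk₁ (w.map M.sym) else Turing.Tape.mk₁ []

/-- Moves by at most one cell. -/
def moveHead {Γ : Type} [Inhabited Γ] : Option Turing.Dir → Turing.Tape Γ → Turing.Tape Γ
  | none, t => t
  | some d, t => t.move d

/-- An ordinary step, with the random bit `b`. -/
def act (M : OracleMachine) (c : M.Cfg) (b : Bool) : M.Cfg :=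
  let r := M.δ c.state (fun i => (c.tape i).head) b
  { state := r.1
    tape := fun i => moveHead (r.2 i).2 ((c.tape i).write (r.2 i).1) }

open Classical in
/-- One step of `M` with the oracle `O` (the set of the words that the oracle answers with `yes`), as
a probability distribution on configurations. The state `halt` is final. -/
noncomputable def step (M : OracleMachine) (O : Set Word) (c : M.Cfg) : PMF M.Cfg :=
  if c.state = M.halt then PMF.pure c
  else if c.state = M.ask then
    PMF.pure { c with
      state := if ∃ w ∈ O, M.Shows (c.tape M.queryTape) w then M.yes else M.no }
  else (PMF.uniformOfFintype Bool).map (M.act c)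

/-- The distribution of the configuration after `T` steps from `c`. -/
noncomputable def run (M : OracleMachine) (O : Set Word) : ℕ → M.Cfg → PMF M.Cfg
  | 0, c => PMF.pure c
  | T + 1, c => (M.step O c).bind (M.run O T)

/-- `M` has halted in `c`, and its output tape shows a word in `A`. -/
def HaltsIn (M : OracleMachine) (A : Set Word) (c : M.Cfg) : Prop :=
  c.state = M.halt ∧ ∃ u ∈ A, M.Shows (c.tape M.outputTape) u

/-- On input `w`, with oracle `O` and for all outcomes of the random bits, `M` halts within `T` steps
with an output in `A`. -/
def Always (M : OracleMachine) (O : Set Word) (w : Word) (T : ℕ) (A : Set Word) : Prop :=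
  ∀ c ∈ (M.run O T (M.init w)).support, M.HaltsIn A c

/-- The probability that `M`, on input `w` and with oracle `O`, halts within `T` steps with an output
in `A`. -/
noncomputable def prob (M : OracleMachine) (O : Set Word) (w : Word) (T : ℕ) (A : Set Word) :
    ENNReal :=
  (M.run O T (M.init w)).toOuterMeasure {c | M.HaltsIn A c}

/-- `M` makes no use of its random bits. -/
def Deterministic (M : OracleMachine) : Prop :=
  ∀ q s b b', M.δ q s b = M.δ q s b'

end OracleMachine

/-! ### Implicit set problems -/

/-- An instance `(E, ℱ, B, oracle)` of an implicit set problem. Only the values of `oracle` on subsets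
of `E` matter (see `queryYes`). -/
structure ImplicitSetInstance : Type where
  E : Finset Elt
  F : Set (Finset Elt)
  F_subset : ∀ S ∈ F, S ⊆ E
  B : List Bool
  oracle : Finset Elt → ℕ → Bool

namespace ImplicitSetInstance

/-- The queries that the oracle of the instance answers with `yes`: the words that represent a pair
`(S, j)` with `S ⊆ E` and `oracle S j = 1`. -/
def queryYes (I : ImplicitSetInstance) : Set Word :=
  {w | ∃ (u : Word) (S : Finset Elt) (j : ℕ), IsSetWord u S ∧ S ⊆ I.E ∧ I.oracle S j = true ∧
    w = u ++ [Letter.hash] ++ natWord j}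

/-- `S` is an `ℓ`-extension of `X`. -/
def IsExtension (I : ImplicitSetInstance) (X : Finset Elt) (ℓ : ℕ) (S : Finset Elt) : Prop :=
  S ⊆ I.E \ X ∧ X ∪ S ∈ I.F ∧ S.card = ℓ

end ImplicitSetInstance

/-- The one-symbol answers of decision algorithms. -/
def yesWord : Word := [Letter.bit true]

def noWord : Word := [Letter.bit false]

/-- The implicit set problem `P` is polynomial time computable: deterministic oracle machines compute
`E` from `B`, and decide `S ∈ ℱ` from `B` and `S ⊆ E`, in time polynomial in `|B|`. -/
def PolyTimeComputable (P : Set ImplicitSetInstance) : Prop :=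
  (∃ M : OracleMachine, M.Deterministic ∧ ∃ p : Polynomial ℕ, ∀ I ∈ P,
    M.Always I.queryYes (bitsWord I.B) (p.eval I.B.length) {u | IsSetWord u I.E}) ∧
  (∃ M : OracleMachine, M.Deterministic ∧ ∃ p : Polynomial ℕ, ∀ I ∈ P,
    ∀ S ⊆ I.E, ∀ s : Word, IsSetWord s S →
      M.Always I.queryYes (bitsWord I.B ++ [Letter.hash] ++ s) (p.eval I.B.length)
        {u | (S ∈ I.F ∧ u = yesWord) ∨ (S ∉ I.F ∧ u = noWord)})

/-- `M` is a random extension algorithm for `P` of time `g`: given `B`, a set `X ⊆ E` and `ℓ`, it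
halts within `g(ℓ) · poly(|B|)` steps and returns `⊥` or an `ℓ`-extension of `X`, the latter with
probability at least `1/2` if there is one. -/
def IsExtensionAlgorithm (M : OracleMachine) (P : Set ImplicitSetInstance) (g : ℕ → ℕ) : Prop :=
  ∃ p : Polynomial ℕ, ∀ I ∈ P, ∀ X ⊆ I.E, ∀ x : Word, IsSetWord x X → ∀ ℓ : ℕ,
    let input := bitsWord I.B ++ [Letter.hash] ++ x ++ [Letter.hash] ++ natWord ℓ
    let T := g ℓ * p.eval I.B.length
    let good : Set Word := {u | ∃ S, IsSetWord u S ∧ I.IsExtension X ℓ S}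
    M.Always I.queryYes input T ({[Letter.bot]} ∪ good) ∧
    ((∃ S, I.IsExtension X ℓ S) → 1 / 2 ≤ M.prob I.queryYes input T good)

/-- `M` is a randomized algorithm for `P` that runs in time `τ`: given `B`, it answers `yes` or `no`
within `τ I` steps; a `yes`-instance (`ℱ ≠ ∅`) is answered by `yes` with probability at least `1/2`,
a `no`-instance (`ℱ = ∅`) always by `no`. -/
def IsRandomizedAlgorithm (M : OracleMachine) (P : Set ImplicitSetInstance)
    (τ : ImplicitSetInstance → ℝ) : Prop :=
  ∀ I ∈ P, ∃ T : ℕ, (T : ℝ) ≤ τ I ∧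
    M.Always I.queryYes (bitsWord I.B) T {yesWord, noWord} ∧
    (I.F.Nonempty → 1 / 2 ≤ M.prob I.queryYes (bitsWord I.B) T {yesWord}) ∧
    (I.F = ∅ → M.Always I.queryYes (bitsWord I.B) T {noWord})

/-! ### The functions in the running time -/

/-- `f = Ω(h)`. -/
def IsOmega (f h : ℕ → ℝ) : Prop :=
  ∃ c : ℝ, 0 < c ∧ ∀ᶠ n in Filter.atTop, c * h n ≤ f n

/-- `log² n`, with the logarithm in base `2`. -/
noncomputable def logSq (n : ℕ) : ℝ := (Real.logb 2 n) ^ 2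

/-- `g(ℓ) = ⌊2^(α ℓ²)⌋`. -/
noncomputable def expSq (α : ℝ) (ℓ : ℕ) : ℕ := ⌊(2 : ℝ) ^ (α * (ℓ : ℝ) ^ 2)⌋₊

/-- `Φ_g(n)`, the maximum of `ℓ log (n / (4 ℓ)) - log g(ℓ)` over the integers `0 ≤ ℓ ≤ n / 4`; the
first term is read as `0` for `ℓ = 0`. -/
noncomputable def Phi (g : ℕ → ℕ) (n : ℕ) : ℝ :=
  (Finset.range (n / 4 + 1)).sup' ⟨0, by simp⟩
    (fun ℓ => (ℓ : ℝ) * Real.logb 2 ((n : ℝ) / (4 * (ℓ : ℝ))) - Real.logb 2 (g ℓ : ℝ))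

/-! The algorithm samples at random, with one fixed extension size. Let n = |E|. In each trial a
fair bit chooses between two experiments: either X contains every element with probability 1/2 and
the extension algorithm is asked for a λ-extension of X, or X contains every element with
probability 1/4 and it is asked for a 0-extension, which tests whether X itself lies in ℱ. Any
answer other than ⊥ proves ℱ ≠ ∅, so the error is one-sided.

Fix S ∈ ℱ with |S| = k. The first experiment produces some X ⊆ S with |X| = k - λ with probability
C(k, λ) / 2^n; the second produces S with probability 3^(n-k) / 4^n. Let λ = `lam B n` be the number
of digits of n to base 2^(d+4), and σ = `saved B d n` = d · C(λ, 2). One of the two probabilities is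
at least 2^σ / 2^n (`success_le`): the first if k ≥ n/4, because C(k, λ) is at least about (k/λ)^λ;
the second if k < n/4, because 3^(n-k) then beats 2^n by an exponential factor, while σ ≤ n/6. The
choice of the experiment and the error of the extension algorithm cost a factor 4 (`trialFail_le`),
so 2^(n+2-σ) independent trials all fail with probability at most 1/2 (`pow_le_half`). The total
time is 2^(n-σ) · g(λ) up to a polynomial factor. Since g(λ) ≤ 2^(αλ²), the saving in the exponent
is σ - αλ², which is Ω(log² n) when d ≥ 4α + 2 (`isOmega_saving`). The bound for Φ comes from
evaluating the maximum at ℓ = ⌊log n / D⌋ (`isOmega_Phi`).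

Most of the work is the realisation on a Turing machine, which must find λ and the number of trials
by itself. A counter to base 2^(d+4) counts the elements, and the trial counter starts as n + 2
binary zeros. Whenever the first counter grows from λ to λ + 1 digits, dλ zeros are erased from the
second; in total this makes d · C(λ, 2). The two subroutines run on embedded tapes, and a unary
clock bounds the cells they can have touched, so that these can be wiped before the next run
(`reach_clean`).

Time and error probability are tracked together by `Reach`: final configurations carry a value, at
least 1 for the answer `no` and at least 0 for a correct `yes`, and u is the expected value. A trial
that fails with probability q turns the value u of the remaining computation into q · u
(`reach_trial`), so r trials give q^r (`reach_loop`). -/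

/-! ### Tapes -/

section Tapes

variable {Γ : Type} [Inhabited Γ]

/-- The tape with `l` to the left of the head (nearest cell first), and `r` from the head on. -/
def tp (l r : List Γ) : Turing.Tape Γ := Turing.Tape.mk₂ l r

@[simp] theorem tp_head_cons (l : List Γ) (a : Γ) (r : List Γ) : (tp l (a :: r)).head = a := rfl

@[simp] theorem tp_write_cons (l : List Γ) (a b : Γ) (r : List Γ) :
    (tp l (a :: r)).write b = tp l (b :: r) := rfl

@[simp] theorem tp_write_nil (l : List Γ) (b : Γ) : (tp l []).write b = tp l [b] := rfl

theorem mk_append_blank (l : List Γ) :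
    Turing.ListBlank.mk (l ++ [default]) = Turing.ListBlank.mk l :=
  Quotient.sound' (Or.inr ⟨1, rfl⟩)

theorem tp_append_blank (l r : List Γ) : tp l (r ++ [default]) = tp l r := by
  simp only [tp, Turing.Tape.mk₂, mk_append_blank]

theorem tp_blank (l : List Γ) : tp l [default] = tp l [] := tp_append_blank l []

theorem tp_left_blank (r : List Γ) : tp [default] r = tp [] r := by
  simp only [tp, Turing.Tape.mk₂]
  rw [show Turing.ListBlank.mk [(default : Γ)] = Turing.ListBlank.mk [] from mk_append_blank []]

@[simp] theorem tp_move_right (l : List Γ) (a : Γ) (r : List Γ) :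
    (tp l (a :: r)).move .right = tp (a :: l) r := by
  simp [tp, Turing.Tape.mk₂]

@[simp] theorem tp_move_left (l : List Γ) (a : Γ) (r : List Γ) :
    (tp (a :: l) r).move .left = tp l (a :: r) := by
  simp [tp, Turing.Tape.mk₂]

theorem tp_move_left_nil (r : List Γ) :
    (tp [] r).move .left = tp [] (default :: r) := by
  rw [← tp_left_blank, tp_move_left]

theorem tp_nth (l r : List Γ) (i : ℕ) : (tp l r).nth i = r.getI i := by
  simp [tp, Turing.Tape.mk₂]

section Option

variable {X : Type} (l r : List (Option X)) (a : Option X)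

@[simp] theorem tp_head_nil_option : (tp l []).head = none := rfl

@[simp] theorem tp_none : tp l [none] = tp l [] := tp_blank l

@[simp] theorem tp_left_none : tp [none] r = tp [] r := tp_left_blank r

@[simp] theorem tp_move_left_nil_option : (tp [] r).move .left = tp [] (none :: r) :=
  tp_move_left_nil r

end Option

theorem tape_ext {s t : Turing.Tape Γ} (h : ∀ i : ℤ, s.nth i = t.nth i) : s = t := by
  obtain ⟨a, l, r⟩ := s
  obtain ⟨a', l', r'⟩ := t
  have h0 : a = a' := h 0
  have h1 : l = l' := Turing.ListBlank.ext fun i => h (Int.negSucc i)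
  have h2 : r = r' := Turing.ListBlank.ext fun i => h (i + 1 : ℕ)
  rw [h0, h1, h2]

theorem tp_nil_nth (i : ℤ) : (tp ([] : List Γ) []).nth i = default := by
  match i with
  | 0 => rfl
  | (n + 1 : ℕ) => simp [tp, Turing.Tape.mk₂, Turing.Tape.mk', Turing.Tape.nth]
  | Int.negSucc n =>
    change (Turing.ListBlank.mk ([] : List Γ)).nth n = default
    simp

theorem tp_nth_neg (r : List Γ) (i : ℤ) (h : i < 0) : (tp [] r).nth i = default := by
  match i with
  | Int.negSucc n =>
    change (Turing.ListBlank.mk ([] : List Γ)).nth n = default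
    simp

/-- All cells of `t` outside `[lo, hi)` are blank; the head is at `0`. -/
def BlankOutside (t : Turing.Tape Γ) (lo hi : ℤ) : Prop :=
  ∀ i : ℤ, (i < lo ∨ hi ≤ i) → t.nth i = default

theorem BlankOutside.tp_nil {r : List Γ} {K : ℕ} (h : r.length ≤ K) :
    BlankOutside (tp [] r) (-K) (K + 1) := by
  rintro i (hi | hi)
  · exact tp_nth_neg r i (by omega)
  · lift i to ℕ using by omega
    rw [tp_nth]
    exact List.getI_eq_default _ (by omega)

theorem BlankOutside.mono {t : Turing.Tape Γ} {lo hi lo' hi' : ℤ} (h : BlankOutside t lo hi)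
    (h1 : lo' ≤ lo) (h2 : hi ≤ hi') : BlankOutside t lo' hi' :=
  fun i hi => h i (by omega)

theorem BlankOutside.write {t : Turing.Tape Γ} {lo hi : ℤ} (h : BlankOutside t lo hi)
    (h1 : lo ≤ 0) (h2 : 0 < hi) (a : Γ) : BlankOutside (t.write a) lo hi := by
  intro i hi
  rw [Turing.Tape.write_nth, if_neg (by omega)]
  exact h i hi

theorem BlankOutside.left {t : Turing.Tape Γ} {lo hi : ℤ} (h : BlankOutside t lo hi) :
    BlankOutside (t.move .left) (lo + 1) (hi + 1) := by
  intro i hi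
  rw [Turing.Tape.move_left_nth]
  exact h _ (by omega)

theorem BlankOutside.right {t : Turing.Tape Γ} {lo hi : ℤ} (h : BlankOutside t lo hi) :
    BlankOutside (t.move .right) (lo - 1) (hi - 1) := by
  intro i hi
  rw [Turing.Tape.move_right_nth]
  exact h _ (by omega)

/-- The cell left behind is blank, so the window does not extend to the left of the new head
position and loses one cell. -/
theorem BlankOutside.erase_right {t : Turing.Tape Γ} {hi : ℤ} (h : BlankOutside t 0 hi) :
    BlankOutside ((t.write default).move .right) 0 (hi - 1) := by
  intro i hi
  rw [Turing.Tape.move_right_nth, Turing.Tape.write_nth]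
  split
  · rfl
  · exact h _ (by omega)

/-- Positions are relative to the head, so a wiped tape equals a fresh one, wherever its head has
wandered. -/
theorem BlankOutside.eq_blank {t : Turing.Tape Γ} {hi : ℤ} (h : BlankOutside t 0 hi)
    (h' : hi ≤ 0) : t = tp [] [] :=
  tape_ext fun i => by rw [tp_nil_nth, h i (by omega)]

/-- One step writes only under the head and moves it by at most one cell. Hence a clock that ticks
at every such step bounds the used part of every tape. -/
theorem BlankOutside.step {t : Turing.Tape Γ} {K : ℕ} (h : BlankOutside t (-K) (K + 1)) (a : Γ)
    (m : Option Turing.Dir) :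
    BlankOutside (OracleMachine.moveHead m (t.write a)) (-(K + 1 : ℕ)) ((K + 1 : ℕ) + 1) := by
  have h' := h.write (by omega) (by omega) a
  rcases m with _ | _ | _
  · exact h'.mono (by push_cast; omega) (by push_cast; omega)
  · exact h'.left.mono (by push_cast; omega) (by push_cast; omega)
  · exact h'.right.mono (by push_cast; omega) (by push_cast; omega)

end Tapes

/-! ### A program logic for randomized machines -/

namespace OracleMachine

variable (M : OracleMachine) (O : Set Word)

open Classical in
/-- The configuration after a consultation of the oracle. -/
noncomputable def answer (c : M.Cfg) : M.Cfg :=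
  { c with state := if ∃ w ∈ O, M.Shows (c.tape M.queryTape) w then M.yes else M.no }

/-- Whatever the random bits are, `M` gets from `c` within `t` steps to a configuration `c'`, with
`R c' x` for some number `x`, and the expectation of `x` is at most `u`. -/
inductive Reach (R : M.Cfg → ℝ → Prop) : ℕ → M.Cfg → ℝ → Prop
  | here {t : ℕ} {c : M.Cfg} {u : ℝ} : R c u → Reach R t c u
  | ask {t : ℕ} {c : M.Cfg} {u : ℝ} : c.state ≠ M.halt → c.state = M.ask →
      Reach R t (M.answer O c) u → Reach R (t + 1) c u
  | flip {t : ℕ} {c : M.Cfg} {u u₁ u₀ : ℝ} : c.state ≠ M.halt → c.state ≠ M.ask →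
      Reach R t (M.act c true) u₁ → Reach R t (M.act c false) u₀ → u = (u₁ + u₀) / 2 →
      Reach R (t + 1) c u

variable {M O}

theorem Reach.mono {R R' : M.Cfg → ℝ → Prop} (hR : ∀ c u, R c u → R' c u) {t t' : ℕ} {c : M.Cfg}
    {u : ℝ} (h : M.Reach O R t c u) (ht : t ≤ t') : M.Reach O R' t' c u := by
  induction h generalizing t' with
  | here h => exact .here (hR _ _ h)
  | ask h1 h2 _ ih =>
    obtain ⟨t', rfl⟩ := Nat.exists_eq_add_of_lt ht
    exact .ask h1 h2 (ih (by omega))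
  | flip h1 h2 _ _ h3 ih1 ih0 =>
    obtain ⟨t', rfl⟩ := Nat.exists_eq_add_of_lt ht
    exact .flip h1 h2 (ih1 (by omega)) (ih0 (by omega)) h3

theorem Reach.mono_time {R : M.Cfg → ℝ → Prop} {t t' : ℕ} {c : M.Cfg} {u : ℝ}
    (h : M.Reach O R t c u) (ht : t ≤ t') : M.Reach O R t' c u :=
  h.mono (fun _ _ h => h) ht

/-- A step in which the random bit plays no role. -/
theorem Reach.step {R : M.Cfg → ℝ → Prop} {t : ℕ} {c c' : M.Cfg} {u : ℝ}
    (h1 : c.state ≠ M.halt) (h2 : c.state ≠ M.ask) (hc : ∀ b, M.act c b = c')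
    (h : M.Reach O R t c' u) : M.Reach O R (t + 1) c u :=
  .flip h1 h2 (by rwa [hc]) (by rwa [hc]) (by ring)

/-- Expectations may be scaled. -/
theorem Reach.scale {R R' : M.Cfg → ℝ → Prop} (a : ℝ) (hR : ∀ c u, R c u → R' c (u * a)) {t : ℕ}
    {c : M.Cfg} {u : ℝ} (h : M.Reach O R t c u) : M.Reach O R' t c (u * a) := by
  induction h with
  | here h => exact .here (hR _ _ h)
  | ask h1 h2 _ ih => exact .ask h1 h2 ih
  | flip h1 h2 _ _ h3 ih1 ih0 => exact .flip h1 h2 ih1 ih0 (by rw [h3]; ring)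

theorem step_halt {c : M.Cfg} (h : c.state = M.halt) : M.step O c = PMF.pure c := if_pos h

theorem step_ask {c : M.Cfg} (h : c.state ≠ M.halt) (h' : c.state = M.ask) :
    M.step O c = PMF.pure (M.answer O c) := by
  rw [step, if_neg h, if_pos h']
  rfl

theorem step_flip {c : M.Cfg} (h : c.state ≠ M.halt) (h' : c.state ≠ M.ask) :
    M.step O c = (PMF.uniformOfFintype Bool).map (M.act c) := by
  rw [step, if_neg h, if_neg h']

theorem run_halt {c : M.Cfg} (h : c.state = M.halt) (t : ℕ) : M.run O t c = PMF.pure c := by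
  induction t with
  | zero => rfl
  | succ t ih => rw [run, step_halt h, PMF.pure_bind, ih]

theorem run_flip {c : M.Cfg} (h : c.state ≠ M.halt) (h' : c.state ≠ M.ask) (t : ℕ) :
    M.run O (t + 1) c = (PMF.uniformOfFintype Bool).bind fun b => M.run O t (M.act c b) := by
  rw [run, step_flip h h', PMF.bind_map]
  rfl

theorem run_flip_support {c : M.Cfg} (h : c.state ≠ M.halt) (h' : c.state ≠ M.ask) (t : ℕ)
    (c' : M.Cfg) :
    c' ∈ (M.run O (t + 1) c).support ↔ ∃ b, c' ∈ (M.run O t (M.act c b)).support := by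
  rw [run_flip h h', PMF.mem_support_bind_iff]
  simp

theorem run_flip_measure {c : M.Cfg} (h : c.state ≠ M.halt) (h' : c.state ≠ M.ask) (t : ℕ)
    (A : Set M.Cfg) :
    (M.run O (t + 1) c).toOuterMeasure A =
      ((M.run O t (M.act c true)).toOuterMeasure A +
        (M.run O t (M.act c false)).toOuterMeasure A) / 2 := by
  rw [run_flip h h', PMF.toOuterMeasure_bind_apply, tsum_fintype]
  simp [ENNReal.div_eq_inv_mul, mul_add]

theorem toOuterMeasure_le_one {α : Type*} (p : PMF α) (A : Set α) : p.toOuterMeasure A ≤ 1 := by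
  rw [PMF.toOuterMeasure_apply, ← p.tsum_coe]
  exact ENNReal.tsum_le_tsum fun a => Set.indicator_le_self _ _ _

/-- The logic is sound: statements about the support. -/
theorem Reach.support {R : M.Cfg → ℝ → Prop} (hR : ∀ c u, R c u → c.state = M.halt) {t : ℕ}
    {c : M.Cfg} {u : ℝ} (h : M.Reach O R t c u) :
    ∀ c' ∈ (M.run O t c).support, ∃ x, R c' x := by
  induction h with
  | here h =>
    rw [run_halt (hR _ _ h)]
    intro c' hc'
    rw [PMF.mem_support_pure_iff] at hc'
    exact ⟨_, hc' ▸ h⟩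
  | ask h1 h2 _ ih =>
    rw [run, step_ask h1 h2, PMF.pure_bind]
    exact ih
  | flip h1 h2 _ _ h3 ih1 ih0 =>
    intro c' hc'
    rw [run_flip_support h1 h2] at hc'
    obtain ⟨_ | _, hb⟩ := hc'
    · exact ih0 _ hb
    · exact ih1 _ hb

/-- The logic is sound: statements about probabilities. -/
theorem Reach.measure_le {R : M.Cfg → ℝ → Prop} (hR : ∀ c u, R c u → c.state = M.halt)
    (hR0 : ∀ c u, R c u → 0 ≤ u) {A : Set M.Cfg} (hA : ∀ c u, R c u → c ∈ A → 1 ≤ u) {t : ℕ}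
    {c : M.Cfg} {u : ℝ} (h : M.Reach O R t c u) :
    0 ≤ u ∧ (M.run O t c).toOuterMeasure A ≤ ENNReal.ofReal u := by
  classical
  induction h with
  | here h =>
    refine ⟨hR0 _ _ h, ?_⟩
    rw [run_halt (hR _ _ h), PMF.toOuterMeasure_pure_apply]
    split
    · rw [← ENNReal.ofReal_one]
      exact ENNReal.ofReal_le_ofReal (hA _ _ h ‹_›)
    · exact zero_le
  | ask h1 h2 _ ih =>
    rw [run, step_ask h1 h2, PMF.pure_bind]
    exact ih
  | flip h1 h2 _ _ h3 ih1 ih0 =>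
    subst h3
    refine ⟨by linarith [ih1.1, ih0.1], ?_⟩
    rw [run_flip_measure h1 h2, ENNReal.ofReal_div_of_pos two_pos,
      ENNReal.ofReal_add ih1.1 ih0.1, ENNReal.ofReal_ofNat]
    gcongr
    exacts [ih1.2, ih0.2]

/-- The logic is complete for halting machines. -/
theorem Reach.of_run (A : Set M.Cfg) (B : Set M.Cfg) (hA : ∀ c ∈ A, c.state = M.halt) (t : ℕ)
    (c : M.Cfg) (h : ∀ c' ∈ (M.run O t c).support, c' ∈ A) :
    M.Reach O (fun c u => c ∈ A ∧ 0 ≤ u ∧ (c ∈ B → u = 1)) t c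
      ((M.run O t c).toOuterMeasure B).toReal := by
  classical
  have leaf : ∀ (t : ℕ) (c : M.Cfg), c ∈ A → M.Reach O (fun c u => c ∈ A ∧ 0 ≤ u ∧ (c ∈ B → u = 1)) t c
      ((M.run O t c).toOuterMeasure B).toReal := by
    intro t c hc
    refine .here ⟨hc, ENNReal.toReal_nonneg, fun hB => ?_⟩
    rw [run_halt (hA c hc), PMF.toOuterMeasure_pure_apply, if_pos hB, ENNReal.toReal_one]
  induction t generalizing c with
  | zero => exact leaf 0 c (h c (by simp [run]))
  | succ t ih =>
    by_cases h1 : c.state = M.halt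
    · exact leaf _ c (h c (by simp [run_halt h1]))
    by_cases h2 : c.state = M.ask
    · rw [run, step_ask h1 h2, PMF.pure_bind] at h ⊢
      exact .ask h1 h2 (ih _ h)
    · refine .flip h1 h2 (ih _ fun c' hc' => h c' ?_) (ih _ fun c' hc' => h c' ?_) ?_
      · exact (run_flip_support h1 h2 _ _).2 ⟨_, hc'⟩
      · exact (run_flip_support h1 h2 _ _).2 ⟨_, hc'⟩
      · rw [run_flip_measure h1 h2, ENNReal.toReal_div, ENNReal.toReal_add, ENNReal.toReal_ofNat]
        · exact ((toOuterMeasure_le_one _ _).trans_lt ENNReal.one_lt_top).ne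
        · exact ((toOuterMeasure_le_one _ _).trans_lt ENNReal.one_lt_top).ne

end OracleMachine

/-! ### The search machine -/

namespace Search

instance : Fintype Letter :=
  ⟨⟨([.bit true, .bit false, .comma, .hash, .bot] : List Letter), by simp⟩,
    by rintro ((_ | _) | _ | _ | _) <;> simp⟩

/-- The work tapes of the search machine: the input, the trial counter, the size counter, the
parameter `ℓ`, the ground set, the clock, and the answer. -/
inductive Own : Type
  | inp | ctr | z | ell | els | clk | ans
  deriving DecidableEq

instance : Fintype Own :=
  ⟨{.inp, .ctr, .z, .ell, .els, .clk, .ans}, by rintro (_ | _) <;> simp⟩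

/-- The places in the program where a tape is rewound. -/
inductive Rew : Type
  | inpE | feedE | els | z | ell | elsEnd | inpX | elsX | ellX | feedX | ctr
  deriving DecidableEq

instance : Fintype Rew :=
  ⟨{.inpE, .feedE, .els, .z, .ell, .elsEnd, .inpX, .elsX, .ellX, .feedX, .ctr},
    by rintro (_ | _) <;> simp⟩

/-- The labels of the program. -/
inductive Lab (d : ℕ) : Type
  | feedB (k : Bool)
  | pick (t : Bool)
  | pick'
  | take (t : Bool)
  | skip (t : Bool)
  | feedL (t : Bool)
  | rew (r : Rew)
  | rew' (r : Rew)
  | copyE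
  | clean₀ (k : Bool)
  | clean₁ (k : Bool)
  | clean₂ (k : Bool)
  | clean₃ (k : Bool)
  | count
  | incZ
  | drop (i : Fin (d + 1))
  | incL
  | incC
  | ask
  | yes
  | no
  | halt
  deriving DecidableEq, Fintype

variable (N : Bool → OracleMachine) (B d : ℕ)

/-- The tapes of the two subroutines; they share the query tape, which is `none`. -/
abbrev Sub : Type := Option (Σ k, (N k).Tp)

abbrev Tapes : Type := Own ⊕ Sub N

/-- The tape alphabet; its last part are the digits to base `B + 2`. -/
abbrev Sy : Type := Option (Letter ⊕ (Σ k, (N k).Γ) ⊕ Fin (B + 2))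

abbrev St : Type := Lab d ⊕ (Σ k, (N k).State)

variable {N B d}

abbrev lt (a : Letter) : Sy N B := some (.inl a)

abbrev dig (i : Fin (B + 2)) : Sy N B := some (.inr (.inr i))

abbrev mark : Sy N B := lt .comma

/-- The place of tape `i` of subroutine `k`. -/
def place (k : Bool) (i : (N k).Tp) : Sub N := if i = (N k).queryTape then none else some ⟨k, i⟩

theorem place_query (k : Bool) : place k (N k).queryTape = none := if_pos rfl

theorem place_injective (k : Bool) : Function.Injective (place (N := N) k) := by
  intro i j h
  unfold place at h
  split_ifs at h with h1 h2 h2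
  · rw [h1, h2]
  · simpa using h

open Classical in
/-- The translation of the symbols of subroutine `k`. -/
noncomputable def enc (k : Bool) (x : (N k).Γ) : Sy N B :=
  if x = default then none else
    if h : ∃ a, (N k).sym a = x then lt h.choose else some (.inr (.inl ⟨k, x⟩))

/-- The symbol of subroutine `k` that is encoded by a symbol. -/
def dec (k : Bool) : Sy N B → (N k).Γ
  | some (.inl a) => (N k).sym a
  | some (.inr (.inl ⟨k', x⟩)) => if h : k' = k then h ▸ x else default
  | _ => default

theorem dec_enc (k : Bool) (x : (N k).Γ) : dec k (enc (B := B) k x) = x := by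
  unfold enc
  split_ifs with h1 h2
  · rw [h1]; rfl
  · exact h2.choose_spec
  · simp [dec]

theorem enc_default (k : Bool) : enc (B := B) k (default : (N k).Γ) = default := if_pos rfl

theorem enc_sym (k : Bool) (a : Letter) : enc (B := B) k ((N k).sym a) = lt a := by
  have h : ∃ a', (N k).sym a' = (N k).sym a := ⟨a, rfl⟩
  rw [enc, if_neg ((N k).sym_ne_blank a), dif_pos h]
  rw [(N k).sym_injective h.choose_spec]

theorem enc_injective (k : Bool) : Function.Injective (enc (N := N) (B := B) k) :=
  Function.LeftInverse.injective (dec_enc k)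

/-- Actions on the tapes. -/
abbrev Acts (N : Bool → OracleMachine) (B : ℕ) : Type :=
  Tapes N → Sy N B × Option Turing.Dir

/-- The action that changes nothing. -/
def keep (s : Tapes N → Sy N B) : Acts N B := fun j => (s j, none)

/-- On tape `j`, write `x` and then move. -/
def Acts.on (a : Acts N B) (j : Tapes N) (x : Sy N B) (m : Option Turing.Dir) : Acts N B :=
  Function.update a j (x, m)

/-- The same for a work tape. -/
abbrev Acts.own (a : Acts N B) (j : Own) (x : Sy N B) (m : Option Turing.Dir) : Acts N B :=
  a.on (.inl j) x m

/-- Write `x` on the input tape of subroutine `k`, and advance the clock. -/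
def Acts.feed (a : Acts N B) (k : Bool) (x : Sy N B) : Acts N B :=
  (a.on (.inr (place k (N k).inputTape)) x (some .right)).own .clk mark (some .right)

/-- Do the same on all tapes of the subroutines. -/
def Acts.subs (a : Acts N B) (f : Sub N → Sy N B × Option Turing.Dir) : Acts N B :=
  Sum.elim (fun j => a (.inl j)) f

def Rew.tape : Rew → Tapes N
  | .inpE => .inl .inp
  | .feedE => .inr (place false (N false).inputTape)
  | .els => .inl .els
  | .z => .inl .z
  | .ell => .inl .ell
  | .elsEnd => .inl .els
  | .inpX => .inl .inp
  | .elsX => .inl .els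
  | .ellX => .inl .ell
  | .feedX => .inr (place true (N true).inputTape)
  | .ctr => .inl .ctr

def Rew.next : Rew → St N d
  | .inpE => .inl (.rew .feedE)
  | .feedE => .inr ⟨false, (N false).start⟩
  | .els => .inl .count
  | .z => .inl .count
  | .ell => .inl .count
  | .elsEnd => .inl (.rew .ctr)
  | .inpX => .inl (.rew .elsX)
  | .elsX => .inl (.rew .ellX)
  | .ellX => .inl (.rew .feedX)
  | .feedX => .inr ⟨true, (N true).start⟩
  | .ctr => .inl (.feedB true)

/-- The program, except for the steps inside the subroutines. -/
def labStep (s : Tapes N → Sy N B) (c : Bool) : Lab d → St N d × Acts N B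
  | .feedB k => match s (.inl .inp), k with
    | some a, _ => (.inl (.feedB k), ((keep s).feed k (some a)).own .inp (some a) (some .right))
    -- The first of the two extra zeros of the trial counter; they account for the factor 4 in the
    -- number of trials.
    | none, false => (.inl (.rew .inpE), (keep s).own .ctr (lt (.bit false)) (some .right))
    -- The random bit selects the experiment: sampling rate 1/2 with extension size λ, or rate 1/4
    -- with size 0.
    | none, true => (.inl (.pick c), (keep s).feed true (lt .hash))
  | .pick t => match s (.inl .els) with
    | none => (.inl (.feedL t), (keep s).feed true (lt .hash))
    | some _ => (.inl (if c then (if t then .take t else .pick') else .skip t), keep s)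
  | .pick' => (.inl (if c then .take false else .skip false), keep s)
  | .take t => match s (.inl .els) with
    | some (.inl .comma) =>
      (.inl (.pick t), ((keep s).feed true mark).own .els mark (some .right))
    | x => (.inl (.take t), ((keep s).feed true x).own .els x (some .right))
  | .skip t => match s (.inl .els) with
    | some (.inl .comma) => (.inl (.pick t), (keep s).own .els mark (some .right))
    | x => (.inl (.skip t), (keep s).own .els x (some .right))
  -- For `t = false` nothing is written: the empty word encodes the number 0.
  | .feedL t => match t, s (.inl .ell) with
    | true, some a =>
      (.inl (.feedL t), ((keep s).feed true (some a)).own .ell (some a) (some .right))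
    | _, _ => (.inl (.rew .inpX), keep s)
  -- The first move is unconditional, because the head may stand on the blank behind the word.
  | .rew r => (.inl (.rew' r), (keep s).on r.tape (s r.tape) (some .left))
  | .rew' r => match s r.tape with
    | some a => (.inl (.rew' r), (keep s).on r.tape (some a) (some .left))
    | none => (r.next, (keep s).on r.tape none (some .right))
  | .copyE => match s (.inr (place false (N false).outputTape)) with
    | some (.inl .comma) => (.inl .copyE,
      ((((keep s).on (.inr (place false (N false).outputTape)) mark (some .right)).own
        .clk mark (some .right)).own .els mark (some .right)).own .ctr (lt (.bit false))
          (some .right))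
    | some a => (.inl .copyE,
      (((keep s).on (.inr (place false (N false).outputTape)) (some a) (some .right)).own
        .clk mark (some .right)).own .els (some a) (some .right))
    | none => (.inl (.clean₀ false), (keep s).own .ctr (lt (.bit false)) (some .right))
  | .clean₀ k => (.inl (.clean₁ k), (keep s).own .clk (s (.inl .clk)) (some .left))
  | .clean₁ k => match s (.inl .clk) with
    | some a => (.inl (.clean₁ k),
      ((keep s).own .clk (some a) (some .left)).subs fun j => (s (.inr j), some .left))
    | none => (.inl (.clean₂ k), (keep s).own .clk none (some .right))
  | .clean₂ k => match s (.inl .clk) with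
    | some a => (.inl (.clean₂ k),
      ((keep s).own .clk (some a) (some .right)).subs fun _ => (none, some .right))
    | none => (.inl (.clean₃ k),
      ((keep s).own .clk none (some .left)).subs fun _ => (none, some .right))
  | .clean₃ k => match s (.inl .clk), k with
    | some _, _ => (.inl (.clean₃ k),
      ((keep s).own .clk none (some .left)).subs fun _ => (none, some .right))
    | none, false => (.inl (.rew .els), (keep s).own .ctr (s (.inl .ctr)) (some .left))
    | none, true => (.inl .incC, keep s)
  | .count => match s (.inl .els) with
    | some (.inl .comma) => (.inl .incZ, (keep s).own .els mark (some .right))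
    | some a => (.inl .count, (keep s).own .els (some a) (some .right))
    | none => (.inl (.rew .elsEnd), keep s)
  | .incZ => match s (.inl .z) with
    | some (.inr (.inr i)) =>
      if h : i.val + 1 < B + 2 then (.inl (.rew .z), (keep s).own .z (dig ⟨i + 1, h⟩) none)
      else (.inl .incZ, (keep s).own .z (dig 0) (some .right))
    -- The carry has run past the last digit, so a new digit is written. On the way back, `d` zeros
    -- of the trial counter are erased for every old digit.
    | _ => (.inl (.drop 0), (keep s).own .z (dig 1) (some .left))
  | .drop i =>
    if i.val = 0 then
      match s (.inl .z) with
      | some a => (.inl (.drop (Fin.last d)), (keep s).own .z (some a) (some .left))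
      | none => (.inl .incL, (keep s).own .z none (some .right))
    else (.inl (.drop ⟨i - 1, by omega⟩), (keep s).own .ctr none (some .left))
  | .incL => match s (.inl .ell) with
    | some (.inl (.bit true)) => (.inl .incL, (keep s).own .ell (lt (.bit false)) (some .right))
    | _ => (.inl (.rew .ell), (keep s).own .ell (lt (.bit true)) none)
  | .incC => match s (.inl .ctr) with
    | some (.inl (.bit true)) => (.inl .incC, (keep s).own .ctr (lt (.bit false)) (some .right))
    | some _ => (.inl (.rew .ctr), (keep s).own .ctr (lt (.bit true)) none)
    -- Overflow: every value of the counter has been used for one unsuccessful trial.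
    | none => (.inl .halt, (keep s).own .ans (lt (.bit false)) none)
  | .ask => (.inl .halt, keep s)
  | .yes => match s (.inl .clk) with
    | some (.inl (.bit k)) => (.inr ⟨k, (N k).yes⟩, (keep s).own .clk mark (some .right))
    | _ => (.inl .halt, keep s)
  | .no => match s (.inl .clk) with
    | some (.inl (.bit k)) => (.inr ⟨k, (N k).no⟩, (keep s).own .clk mark (some .right))
    | _ => (.inl .halt, keep s)
  | .halt => (.inl .halt, keep s)

/-- What happens when a subroutine has halted. -/
def subEnd (s : Tapes N → Sy N B) : Bool → St N d × Acts N B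
  | false => (.inl .copyE, keep s)
  | true => match s (.inr (place true (N true).outputTape)) with
    | some (.inl .bot) => (.inl (.clean₀ true), keep s)
    | _ => (.inl .halt, (keep s).own .ans (lt (.bit true)) none)

open Classical in
/-- A step inside subroutine `k`. -/
noncomputable def subStep (s : Tapes N → Sy N B) (c : Bool) (k : Bool) (q : (N k).State) :
    St N d × Acts N B :=
  if q = (N k).halt then subEnd s k
  -- The states `yes` and `no` are shared by both subroutines, so the return address `k` is parked
  -- on the clock tape during the query.
  else if q = (N k).ask then (.inl .ask, (keep s).own .clk (lt (.bit k)) none)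
  else
    let r := (N k).δ q (fun i => dec k (s (.inr (place k i)))) c
    (.inr ⟨k, r.1⟩, ((keep s).own .clk mark (some .right)).subs
      (Function.extend (place k) (fun i => (enc k (r.2 i).1, (r.2 i).2))
        fun j => (s (.inr j), none)))

variable (N B d) in
/-- The search machine. -/
noncomputable def machine : OracleMachine where
  Tp := Tapes N
  State := St N d
  Γ := Sy N B
  sym := lt
  sym_injective := fun a b h => by simpa using h
  sym_ne_blank := fun a => by simp [default]
  inputTape := .inl .inp
  outputTape := .inl .ans
  queryTape := .inr none
  start := .inl (.feedB false)
  halt := .inl .halt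
  ask := .inl .ask
  yes := .inl .yes
  no := .inl .no
  δ := fun q s c => match q with
    | .inl q => labStep s c q
    | .inr ⟨k, q⟩ => subStep s c k q

/-! ### Configurations of the search machine -/

/-- The contents of the work tapes. -/
structure OwnTapes (N : Bool → OracleMachine) (B : ℕ) : Type where
  inp : Turing.Tape (Sy N B)
  ctr : Turing.Tape (Sy N B)
  z : Turing.Tape (Sy N B)
  ell : Turing.Tape (Sy N B)
  els : Turing.Tape (Sy N B)
  clk : Turing.Tape (Sy N B)
  ans : Turing.Tape (Sy N B)

def OwnTapes.get (o : OwnTapes N B) : Own → Turing.Tape (Sy N B)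
  | .inp => o.inp
  | .ctr => o.ctr
  | .z => o.z
  | .ell => o.ell
  | .els => o.els
  | .clk => o.clk
  | .ans => o.ans

/-- All tapes: the work tapes `o`, and the tapes `s` of the subroutines. -/
def join (o : OwnTapes N B) (s : Sub N → Turing.Tape (Sy N B)) :
    Tapes N → Turing.Tape (Sy N B) := Sum.elim o.get s

/-- The configuration with state `q` and tapes `t`. -/
def cfg (q : St N d) (t : Tapes N → Turing.Tape (Sy N B)) : (machine N B d).Cfg := ⟨q, t⟩

/-- The configuration with state `q`, work tapes `o`, and tapes `s` of the subroutines. -/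
abbrev conf (q : St N d) (o : OwnTapes N B) (s : Sub N → Turing.Tape (Sy N B)) :
    (machine N B d).Cfg :=
  cfg q (join o s)

/-- The effect of actions on tapes. -/
def applyActs (t : Tapes N → Turing.Tape (Sy N B)) (a : Acts N B) :
    Tapes N → Turing.Tape (Sy N B) :=
  fun j => OracleMachine.moveHead (a j).2 ((t j).write (a j).1)

@[simp] theorem applyActs_keep (t : Tapes N → Turing.Tape (Sy N B)) :
    applyActs t (keep fun j => (t j).head) = t := by
  funext j
  simp [applyActs, keep, OracleMachine.moveHead]

@[simp] theorem applyActs_on (t : Tapes N → Turing.Tape (Sy N B)) (a : Acts N B) (j : Tapes N)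
    (x : Sy N B) (m : Option Turing.Dir) :
    applyActs t (a.on j x m) =
      Function.update (applyActs t a) j (OracleMachine.moveHead m ((t j).write x)) := by
  funext i
  by_cases h : i = j
  · subst h; simp [applyActs, Acts.on]
  · simp [applyActs, Acts.on, h]

/-- Replace the tapes of the subroutines. -/
def setSubs (t : Tapes N → Turing.Tape (Sy N B)) (s : Sub N → Turing.Tape (Sy N B)) :
    Tapes N → Turing.Tape (Sy N B) := Sum.elim (fun j => t (.inl j)) s

@[simp] theorem setSubs_join (o : OwnTapes N B) (s s' : Sub N → Turing.Tape (Sy N B)) :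
    setSubs (join o s) s' = join o s' := rfl

@[simp] theorem applyActs_subs (t : Tapes N → Turing.Tape (Sy N B)) (a : Acts N B)
    (f : Sub N → Sy N B × Option Turing.Dir) :
    applyActs t (a.subs f) = setSubs (applyActs t a)
      fun j => OracleMachine.moveHead (f j).2 ((t (.inr j)).write (f j).1) := by
  funext i
  rcases i with i | i <;> rfl

section Updates

variable (o : OwnTapes N B) (s : Sub N → Turing.Tape (Sy N B)) (x : Turing.Tape (Sy N B))

@[simp] theorem join_inp : join o s (.inl .inp) = o.inp := rfl
@[simp] theorem join_ctr : join o s (.inl .ctr) = o.ctr := rfl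
@[simp] theorem join_z : join o s (.inl .z) = o.z := rfl
@[simp] theorem join_ell : join o s (.inl .ell) = o.ell := rfl
@[simp] theorem join_els : join o s (.inl .els) = o.els := rfl
@[simp] theorem join_clk : join o s (.inl .clk) = o.clk := rfl
@[simp] theorem join_ans : join o s (.inl .ans) = o.ans := rfl
@[simp] theorem join_sub (j : Sub N) : join o s (.inr j) = s j := rfl

@[simp] theorem update_inp : Function.update (join o s) (.inl .inp) x =
    join {o with inp := x} s := by
  funext i; rcases i with (_ | _) | _ <;> simp [join, OwnTapes.get]

@[simp] theorem update_ctr : Function.update (join o s) (.inl .ctr) x =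
    join {o with ctr := x} s := by
  funext i; rcases i with (_ | _) | _ <;> simp [join, OwnTapes.get]

@[simp] theorem update_z : Function.update (join o s) (.inl .z) x =
    join {o with z := x} s := by
  funext i; rcases i with (_ | _) | _ <;> simp [join, OwnTapes.get]

@[simp] theorem update_ell : Function.update (join o s) (.inl .ell) x =
    join {o with ell := x} s := by
  funext i; rcases i with (_ | _) | _ <;> simp [join, OwnTapes.get]

@[simp] theorem update_els : Function.update (join o s) (.inl .els) x =
    join {o with els := x} s := by
  funext i; rcases i with (_ | _) | _ <;> simp [join, OwnTapes.get]

@[simp] theorem update_clk : Function.update (join o s) (.inl .clk) x =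
    join {o with clk := x} s := by
  funext i; rcases i with (_ | _) | _ <;> simp [join, OwnTapes.get]

@[simp] theorem update_ans : Function.update (join o s) (.inl .ans) x =
    join {o with ans := x} s := by
  funext i; rcases i with (_ | _) | _ <;> simp [join, OwnTapes.get]

@[simp] theorem update_sub (j : Sub N) : Function.update (join o s) (.inr j) x =
    join o (Function.update s j x) := by
  funext i
  rcases i with i | i
  · simp [join]
  · by_cases h : i = j
    · subst h; simp
    · simp [join, h]

end Updates

/-! ### Single steps of the program -/

variable {O : Set Word}

theorem act_lab (q : Lab d) (t : Tapes N → Turing.Tape (Sy N B)) (c : Bool) :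
    (machine N B d).act (cfg (.inl q) t) c =
      cfg (labStep (fun j => (t j).head) c q).1 (applyActs t
        (labStep (d := d) (fun j => (t j).head) c q).2) := rfl

theorem act_sub (k : Bool) (q : (N k).State) (t : Tapes N → Turing.Tape (Sy N B)) (c : Bool) :
    (machine N B d).act (cfg (.inr ⟨k, q⟩) t) c =
      cfg (subStep (d := d) (fun j => (t j).head) c k q).1
        (applyActs t (subStep (d := d) (fun j => (t j).head) c k q).2) := rfl

/-- A step of the program in which the random bit plays no role. -/
theorem reach_step {R : (machine N B d).Cfg → ℝ → Prop} {T : ℕ} {q : Lab d} {q' : St N d}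
    {t t' : Tapes N → Turing.Tape (Sy N B)} {u : ℝ}
    (hr : (machine N B d).Reach O R T (cfg q' t') u)
    (h : ∀ c, (labStep (fun j => (t j).head) c q).1 = q' ∧
      applyActs t (labStep (d := d) (fun j => (t j).head) c q).2 = t')
    (h1 : q ≠ .halt := by simp) (h2 : q ≠ .ask := by simp) :
    (machine N B d).Reach O R (T + 1) (cfg (.inl q) t) u := by
  refine .step (c' := (cfg q' t')) (fun h => h1 (Sum.inl.inj h)) (fun h => h2 (Sum.inl.inj h))
    (fun c => ?_) hr
  rw [act_lab, (h c).1, (h c).2]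

/-- A step of the program that depends on the random bit. -/
theorem reach_flip {R : (machine N B d).Cfg → ℝ → Prop} {T : ℕ} {q : Lab d} {q' : Bool → St N d}
    {t : Tapes N → Turing.Tape (Sy N B)} {t' : Bool → Tapes N → Turing.Tape (Sy N B)}
    {u : Bool → ℝ} {v : ℝ}
    (hr : ∀ c, (machine N B d).Reach O R T (cfg (q' c) (t' c)) (u c)) (hv : v = (u true + u false) / 2)
    (h : ∀ c, (labStep (fun j => (t j).head) c q).1 = q' c ∧
      applyActs t (labStep (d := d) (fun j => (t j).head) c q).2 = t' c)
    (h1 : q ≠ .halt := by simp) (h2 : q ≠ .ask := by simp) :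
    (machine N B d).Reach O R (T + 1) (cfg (.inl q) t) v := by
  refine .flip (fun h => h1 (Sum.inl.inj h)) (fun h => h2 (Sum.inl.inj h)) ?_ ?_ hv
  · rw [act_lab, (h true).1, (h true).2]; exact hr true
  · rw [act_lab, (h false).1, (h false).2]; exact hr false

end Search

namespace Search

/-! ### Words, clock and subroutine inputs on tapes -/

open OracleMachine (moveHead)

variable {N : Bool → OracleMachine} {B d : ℕ} {O : Set Word}
  {R : (machine N B d).Cfg → ℝ → Prop} {T : ℕ} {u : ℝ}

/-- A word on a tape. -/
abbrev syms (w : Word) : List (Sy N B) := w.map lt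

/-- A bit string on a tape. -/
def bits (c : List Bool) : List (Sy N B) := c.map fun b => lt (.bit b)

theorem syms_bitsWord (c : List Bool) : (syms (bitsWord c) : List (Sy N B)) = bits c := by
  simp [bits, bitsWord]

@[simp] theorem bits_nil : (bits [] : List (Sy N B)) = [] := rfl

@[simp] theorem bits_cons (b : Bool) (c : List Bool) :
    (bits (b :: c) : List (Sy N B)) = lt (.bit b) :: bits c := rfl

@[simp] theorem bits_append (c c' : List Bool) :
    (bits (c ++ c') : List (Sy N B)) = bits c ++ bits c' := List.map_append

@[simp] theorem bits_length (c : List Bool) : (bits c : List (Sy N B)).length = c.length :=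
  List.length_map _

@[simp] theorem none_notMem_bits (c : List Bool) : none ∉ (bits c : List (Sy N B)) := by
  simp [bits]

/-- The clock after `n` ticks. -/
def ck (n : ℕ) : Turing.Tape (Sy N B) := tp (List.replicate n mark) []

@[simp] theorem ck_head (n : ℕ) : (ck n : Turing.Tape (Sy N B)).head = none := rfl

@[simp] theorem ck_tick (n : ℕ) : ((ck n : Turing.Tape (Sy N B)).write mark).move .right = ck (n + 1) := by
  simp [ck, List.replicate_succ]

/-- The tapes of the subroutines, when the input of subroutine `k` is being written. -/
def feedTapes (k : Bool) (l r : List (Sy N B)) : Sub N → Turing.Tape (Sy N B) :=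
  Function.update (fun _ => tp [] []) (place k (N k).inputTape) (tp l r)

@[simp] theorem feedTapes_self (k : Bool) (l r : List (Sy N B)) :
    feedTapes k l r (place k (N k).inputTape) = tp l r := Function.update_self _ _ _

@[simp] theorem update_feedTapes (k : Bool) (l r l' r' : List (Sy N B)) :
    Function.update (feedTapes k l r) (place k (N k).inputTape) (tp l' r') = feedTapes k l' r' :=
  Function.update_idem _ _ _

theorem feedTapes_nil (k : Bool) :
    feedTapes k [] [] = fun _ : Sub N => (tp [] [] : Turing.Tape (Sy N B)) :=
  Function.update_eq_self _ _

/-! ### Rewinding -/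

theorem reach_rew' (r : Rew) (t : Tapes N → Turing.Tape (Sy N B)) (l : List (Sy N B))
    (hl : none ∉ l) (a : Sy N B) (ha : a ≠ none) (x : List (Sy N B))
    (h : (machine N B d).Reach O R T
      (cfg r.next (Function.update t r.tape (tp [] (l.reverse ++ a :: x)))) u) :
    (machine N B d).Reach O R (T + (l.length + 2))
      (cfg (.inl (.rew' r)) (Function.update t r.tape (tp l (a :: x)))) u := by
  induction l generalizing a x with
  | nil =>
    obtain _ | a := a
    · exact absurd rfl ha
    refine reach_step (q' := .inl (.rew' r))
      (t' := Function.update t r.tape (tp [] (none :: some a :: x))) (reach_step h fun _ => ?_)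
      fun _ => ?_
    · simp [labStep, moveHead]
    · simp [labStep, moveHead]
  | cons b l ih =>
    obtain _ | a := a
    · exact absurd rfl ha
    simp only [List.mem_cons, not_or] at hl
    rw [List.length_cons, show T + (l.length + 1 + 2) = T + (l.length + 2) + 1 by ring]
    refine reach_step (ih hl.2 b (Ne.symm hl.1) (some a :: x) (by simpa using h)) fun _ => ?_
    simp [labStep, moveHead]

/-- The blank to the left of the word serves as the end marker; stepping onto it and back off it
accounts for the two extra steps. -/
theorem reach_rew (r : Rew) (t : Tapes N → Turing.Tape (Sy N B)) (l x : List (Sy N B))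
    (ht : t r.tape = tp l x) (hl : none ∉ l)
    (h : (machine N B d).Reach O R T
      (cfg r.next (Function.update t r.tape (tp [] (l.reverse ++ x)))) u) :
    (machine N B d).Reach O R (T + (l.length + 2)) (cfg (.inl (.rew r)) t) u := by
  cases l with
  | nil =>
    refine reach_step (t' := Function.update t r.tape (tp [] (none :: x)))
      (q' := .inl (.rew' r)) (reach_step h fun _ => ?_) fun _ => ?_
    · simp [labStep, moveHead]
    · simp [labStep, moveHead, ht]
  | cons b l =>
    simp only [List.mem_cons, not_or] at hl
    rw [List.length_cons, show T + (l.length + 1 + 2) = T + (l.length + 2) + 1 by ring]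
    refine reach_step (reach_rew' r t l hl.2 b (Ne.symm hl.1) x (by simpa using h)) fun _ => ?_
    simp [labStep, moveHead, ht]

/-! ### Copying the instance to a subroutine -/

/-- The clock ticks with every symbol written, so that it also covers the part of the subroutine's
input tape that is filled before the subroutine starts. -/
theorem reach_feedB (k : Bool) (o : OwnTapes N B) (w : Word) (l l' : List (Sy N B)) (n : ℕ)
    (h : (machine N B d).Reach O R T (conf (.inl (.feedB k))
      {o with inp := tp ((syms w).reverse ++ l) [], clk := ck (n + w.length)}
      (feedTapes k ((syms w).reverse ++ l') [])) u) :
    (machine N B d).Reach O R (T + w.length) (conf (.inl (.feedB k))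
      {o with inp := tp l (syms w), clk := ck n} (feedTapes k l' [])) u := by
  induction w generalizing l l' n with
  | nil => exact h
  | cons a w ih =>
    refine reach_step (ih (lt a :: l) (lt a :: l') (n + 1) ?_) fun _ => ?_
    · simpa [add_assoc, add_comm 1] using h
    · simp [labStep, moveHead, Acts.feed]

/-- The first phase: the instance is handed over to the first subroutine. -/
theorem reach_startE (o : OwnTapes N B) (w : Word) (c : List (Sy N B))
    (h : (machine N B d).Reach O R T (conf (.inr ⟨false, (N false).start⟩)
      {o with inp := tp [] (syms w), ctr := tp (lt (.bit false) :: c) [], clk := ck w.length}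
      (feedTapes false [] (syms w))) u) :
    (machine N B d).Reach O R (T + (3 * w.length + 5)) (conf (.inl (.feedB false))
      {o with inp := tp [] (syms w), ctr := tp c [], clk := ck 0} (fun _ => tp [] [])) u := by
  have h1 := reach_rew (T := T) (u := u) (R := R) (O := O) .feedE
    (join {o with inp := tp [] (syms w), ctr := tp (lt (.bit false) :: c) [], clk := ck w.length}
      (feedTapes false (syms w).reverse [])) (syms w).reverse [] (by simp [Rew.tape]) (by simp)
    (by simpa [Rew.tape, Rew.next] using h)
  have h2 := reach_rew (R := R) (O := O) (d := d) (u := u) (T := T + (w.length + 2)) .inpE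
    (join {o with inp := tp (syms w).reverse [], ctr := tp (lt (.bit false) :: c) [],
                  clk := ck w.length} (feedTapes false (syms w).reverse [])) (syms w).reverse []
    (by simp [Rew.tape]) (by simp) (by simpa [Rew.tape, Rew.next] using h1)
  rw [← feedTapes_nil false]
  refine (reach_feedB (T := T + (w.length + 2) + (w.length + 2) + 1) false
    {o with ctr := tp c []} w [] [] 0 ?_).mono_time (by omega)
  refine reach_step (by simpa using h2) fun _ => ?_
  simp [labStep, moveHead]

/-! ### Sampling -/

/-- An element as a word. -/
def eltWord (e : Elt) : Word := bitsWord e ++ [Letter.comma]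

theorem eltWord_nil : eltWord [] = [Letter.comma] := rfl

theorem eltWord_cons (b : Bool) (e : Elt) : eltWord (b :: e) = .bit b :: eltWord e := rfl

theorem eltWord_length (e : Elt) : (eltWord e).length = e.length + 1 := by simp [eltWord, bitsWord]

theorem reach_take (t : Bool) (o : OwnTapes N B) (e : Elt) (p q r : List (Sy N B)) (n : ℕ)
    (h : (machine N B d).Reach O R T (conf (.inl (.pick t))
      {o with els := tp ((syms (eltWord e)).reverse ++ p) r,
              clk := ck (n + (eltWord e).length)}
      (feedTapes true ((syms (eltWord e)).reverse ++ q) [])) u) :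
    (machine N B d).Reach O R (T + (e.length + 1)) (conf (.inl (.take t))
      {o with els := tp p (syms (eltWord e) ++ r), clk := ck n}
      (feedTapes true q [])) u := by
  induction e generalizing p q n with
  | nil =>
    refine reach_step h fun _ => ?_
    simp [labStep, moveHead, Acts.feed, eltWord_nil]
  | cons b e ih =>
    refine reach_step (ih (lt (.bit b) :: p) (lt (.bit b) :: q) (n + 1) ?_) fun _ => ?_
    · simpa [eltWord_cons, add_assoc, add_comm 1] using h
    · simp [labStep, moveHead, Acts.feed, eltWord_cons]

theorem reach_skip (t : Bool) (o : OwnTapes N B) (s : Sub N → Turing.Tape (Sy N B)) (e : Elt)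
    (p r : List (Sy N B))
    (h : (machine N B d).Reach O R T (conf (.inl (.pick t))
      {o with els := tp ((syms (eltWord e)).reverse ++ p) r} s) u) :
    (machine N B d).Reach O R (T + (e.length + 1)) (conf (.inl (.skip t))
      {o with els := tp p (syms (eltWord e) ++ r)} s) u := by
  induction e generalizing p with
  | nil =>
    refine reach_step h fun _ => ?_
    simp [labStep, moveHead, eltWord_nil]
  | cons b e ih =>
    refine reach_step (ih (lt (.bit b) :: p) ?_) fun _ => ?_
    · simpa [eltWord_cons, add_assoc, add_comm 1] using h
    · simp [labStep, moveHead, eltWord_cons]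

/-- The expectation of `φ` on a random sublist, every element being taken with probability `1/2`
or `1/4`, for `t = true` and `t = false`, respectively. -/
noncomputable def avg (t : Bool) : (List Elt → ℝ) → List Elt → ℝ
  | φ, [] => φ []
  | φ, e :: l => if t then (avg t (fun x => φ (e :: x)) l + avg t φ l) / 2
    else (avg t (fun x => φ (e :: x)) l + 3 * avg t φ l) / 4

theorem listWord_cons (e : Elt) (l : List Elt) :
    listWord (e :: l) = eltWord e ++ listWord l := List.flatMap_cons

theorem listWord_length_le {x l : List Elt} (h : x.Sublist l) :
    (listWord x).length ≤ (listWord l).length := by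
  induction h with
  | slnil => rfl
  | cons e _ ih => rw [listWord_cons, List.length_append]; omega
  | cons_cons e _ ih => simp only [listWord_cons, List.length_append]; omega

/-- Each recursive clause of `avg` is the average over the coins for one element: one coin at rate
1/2. At rate 1/4 there are up to two, and the element is taken only if both are heads. -/
theorem reach_pick (t : Bool) (o : OwnTapes N B) (l : List Elt) (φ : List Elt → ℝ)
    (p q : List (Sy N B)) (n : ℕ)
    (h : ∀ x, x.Sublist l → (machine N B d).Reach O R T (conf (.inl (.pick t))
      {o with els := tp ((syms (listWord l)).reverse ++ p) [],
              clk := ck (n + (listWord x).length)}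
      (feedTapes true ((syms (listWord x)).reverse ++ q) [])) (φ x)) :
    (machine N B d).Reach O R (T + 3 * (listWord l).length) (conf (.inl (.pick t))
      {o with els := tp p (syms (listWord l)), clk := ck n}
      (feedTapes true q [])) (avg t φ l) := by
  induction l generalizing φ p q n with
  | nil => exact h [] (by simp)
  | cons e l ih =>
    have hlen : (listWord (e :: l)).length = e.length + 1 + (listWord l).length := by
      simp [listWord_cons, eltWord_length]
    have htake := ih (fun x => φ (e :: x)) ((syms (eltWord e)).reverse ++ p)
      ((syms (eltWord e)).reverse ++ q) (n + (eltWord e).length)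
      fun x hx => by
        simpa [listWord_cons, add_assoc] using h (e :: x) (hx.cons_cons e)
    have hskip := ih φ ((syms (eltWord e)).reverse ++ p) q n fun x hx => by
      simpa [listWord_cons] using h x (hx.cons e)
    have htake' := reach_take t o e p q (syms (listWord l)) n htake
    have hskip' := reach_skip t {o with clk := ck n} (feedTapes true q []) e p
      (syms (listWord l)) hskip
    have hs : (syms (listWord (e :: l)) : List (Sy N B)) =
        syms (eltWord e) ++ syms (listWord l) := by
      simp [listWord_cons]
    rw [hs]
    have hhead : ∃ a, ∃ r, (syms (eltWord e) ++ syms (listWord l) : List (Sy N B)) =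
        some a :: r := by
      cases e
      · exact ⟨_, _, rfl⟩
      · exact ⟨_, _, rfl⟩
    obtain ⟨a, r, har⟩ := hhead
    rw [har] at htake' hskip' ⊢
    rw [hlen]
    cases t with
    | true =>
      refine (reach_flip (q' := fun c => .inl (if c then .take true else .skip true))
        (t' := fun _ => join {o with els := tp p (some a :: r), clk := ck n}
          (feedTapes true q []))
        (T := T + 3 * (listWord l).length + (e.length + 1))
        (u := fun c => if c then avg true (fun x => φ (e :: x)) l else avg true φ l)
        (v := avg true φ (e :: l)) ?_ ?_ fun c => ?_).mono_time (by omega)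
      · rintro (_ | _)
        · simpa using hskip'
        · simpa using htake'
      · simp [avg]
      · constructor
        · simp [labStep]
        · simp [labStep]
    | false =>
      have h2 : (machine N B d).Reach O R (T + 3 * (listWord l).length + (e.length + 1) + 1)
          (conf (.inl .pick') {o with els := tp p (some a :: r), clk := ck n}
          (feedTapes true q [])) ((avg false (fun x => φ (e :: x)) l + avg false φ l) / 2) := by
        refine reach_flip (q' := fun c => .inl (if c then .take false else .skip false))
          (t' := fun _ => join {o with els := tp p (some a :: r), clk := ck n}
            (feedTapes true q []))
          (u := fun c => if c then avg false (fun x => φ (e :: x)) l else avg false φ l)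
          ?_ ?_ fun c => ?_
        · rintro (_ | _)
          · simpa using hskip'
          · simpa using htake'
        · simp
        · simp [labStep]
      refine (reach_flip (q' := fun c => .inl (if c then .pick' else .skip false))
        (t' := fun _ => join {o with els := tp p (some a :: r), clk := ck n}
          (feedTapes true q []))
        (T := T + 3 * (listWord l).length + (e.length + 1) + 1)
        (u := fun c => if c then (avg false (fun x => φ (e :: x)) l + avg false φ l) / 2
          else avg false φ l)
        (v := avg false φ (e :: l)) ?_ ?_ fun c => ?_).mono_time (by omega)
      · rintro (_ | _)
        · simpa using hskip'.mono_time (by omega)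
        · simpa using h2
      · simp [avg]; ring
      · simp [labStep]

/-! ### The input of the second subroutine -/

theorem reach_feedL (o : OwnTapes N B) (w : Word) (l l' : List (Sy N B)) (n : ℕ)
    (h : (machine N B d).Reach O R T (conf (.inl (.feedL true))
      {o with ell := tp ((syms w).reverse ++ l) [], clk := ck (n + w.length)}
      (feedTapes true ((syms w).reverse ++ l') [])) u) :
    (machine N B d).Reach O R (T + w.length) (conf (.inl (.feedL true))
      {o with ell := tp l (syms w), clk := ck n} (feedTapes true l' [])) u := by
  induction w generalizing l l' n with
  | nil => exact h
  | cons a w ih =>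
    refine reach_step (ih (lt a :: l) (lt a :: l') (n + 1) ?_) fun _ => ?_
    · simpa [add_assoc, add_comm 1] using h
    · simp [labStep, moveHead, Acts.feed]

/-- The word on the parameter tape is split at the head: it has been read completely in one
experiment, and not at all in the other. -/
theorem reach_rewX (o : OwnTapes N B) (wi we wl wl' wx : Word)
    (h : (machine N B d).Reach O R T (conf (.inr ⟨true, (N true).start⟩)
      {o with inp := tp [] (syms wi), els := tp [] (syms we), ell := tp [] (syms (wl ++ wl'))}
      (feedTapes true [] (syms wx))) u) :
    (machine N B d).Reach O R (T + (wi.length + we.length + wl.length + wx.length + 8))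
      (conf (.inl (.rew .inpX))
      {o with inp := tp (syms wi).reverse [], els := tp (syms we).reverse [],
              ell := tp (syms wl).reverse (syms wl')}
      (feedTapes true (syms wx).reverse [])) u := by
  have h1 := reach_rew (T := T) (u := u) (R := R) (O := O) .feedX
    (join {o with inp := tp [] (syms wi), els := tp [] (syms we), ell := tp [] (syms (wl ++ wl'))}
      (feedTapes true (syms wx).reverse [])) (syms wx).reverse [] (by simp [Rew.tape]) (by simp)
    (by simpa [Rew.tape, Rew.next] using h)
  have h2 := reach_rew (T := T + ((syms wx : List (Sy N B)).reverse.length + 2)) (u := u) (R := R)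
    (O := O) (d := d) .ellX
    (join {o with inp := tp [] (syms wi), els := tp [] (syms we),
                  ell := tp (syms wl).reverse (syms wl')}
      (feedTapes true (syms wx).reverse [])) (syms wl).reverse (syms wl') (by simp [Rew.tape])
    (by simp) (by simpa [Rew.tape, Rew.next] using h1)
  have h3 := reach_rew (T := T + ((syms wx : List (Sy N B)).reverse.length + 2) +
      ((syms wl : List (Sy N B)).reverse.length + 2)) (u := u) (R := R)
    (O := O) (d := d) .elsX
    (join {o with inp := tp [] (syms wi), els := tp (syms we).reverse [],
                  ell := tp (syms wl).reverse (syms wl')}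
      (feedTapes true (syms wx).reverse [])) (syms we).reverse [] (by simp [Rew.tape])
    (by simp) (by simpa [Rew.tape, Rew.next] using h2)
  have h4 := reach_rew (T := T + ((syms wx : List (Sy N B)).reverse.length + 2) +
      ((syms wl : List (Sy N B)).reverse.length + 2) +
      ((syms we : List (Sy N B)).reverse.length + 2)) (u := u) (R := R)
    (O := O) (d := d) .inpX
    (join {o with inp := tp (syms wi).reverse [], els := tp (syms we).reverse [],
                  ell := tp (syms wl).reverse (syms wl')}
      (feedTapes true (syms wx).reverse [])) (syms wi).reverse [] (by simp [Rew.tape])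
    (by simp) (by simpa [Rew.tape, Rew.next] using h3)
  refine h4.mono_time ?_
  simp only [List.length_reverse, List.length_map]
  omega

/-- The input of the second subroutine. -/
def query (w x y : Word) : Word := w ++ [.hash] ++ x ++ [.hash] ++ y

/-- The first half of a trial: a random input is handed over to the second subroutine. -/
theorem reach_sample (o : OwnTapes N B) (w y : Word) (l : List Elt)
    (φ : Bool → List Elt → ℝ)
    (h : ∀ t x, x.Sublist l → (machine N B d).Reach O R T (conf (.inr ⟨true, (N true).start⟩)
      {o with inp := tp [] (syms w), els := tp [] (syms (listWord l)), ell := tp [] (syms y),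
              clk := ck (query w (listWord x) (if t then y else [])).length}
      (feedTapes true [] (syms (query w (listWord x) (if t then y else []))))) (φ t x)) :
    (machine N B d).Reach O R (T + 5 * (w.length + (listWord l).length + y.length) + 13)
      (conf (.inl (.feedB true))
      {o with inp := tp [] (syms w), els := tp [] (syms (listWord l)), ell := tp [] (syms y),
              clk := ck 0}
      (fun _ => tp [] [])) ((avg true (φ true) l + avg false (φ false) l) / 2) := by
  have key : ∀ t, (machine N B d).Reach O R
      (T + (2 * w.length + 2 * (listWord l).length + 3 * y.length + 12) +
        3 * (listWord l).length) (conf (.inl (.pick t))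
      {o with inp := tp (syms w).reverse [], els := tp [] (syms (listWord l)),
              ell := tp [] (syms y), clk := ck (w.length + 1)}
      (feedTapes true (lt .hash :: (syms w).reverse) [])) (avg t (φ t) l) := by
    intro t
    refine reach_pick t {o with inp := tp (syms w).reverse [], ell := tp [] (syms y)} l (φ t) []
      (lt .hash :: (syms w).reverse) (w.length + 1) fun x hx => ?_
    have hxl := listWord_length_le hx
    have hx := h t x hx
    have e : ∀ z : Word, (lt .hash :: ((syms (listWord x)).reverse ++
        lt .hash :: (syms w).reverse) : List (Sy N B)) =
        (syms (query w (listWord x) [])).reverse := fun z => by simp [query]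
    cases t with
    | true =>
      have h1 := reach_rewX (R := R) (O := O) (T := T) (u := φ true x)
        {o with clk := ck (query w (listWord x) y).length} w (listWord l) y []
        (query w (listWord x) y) (by simpa using hx)
      have h2 := reach_step (q := .feedL true) (t := join
        {o with inp := tp (syms w).reverse [], els := tp (syms (listWord l)).reverse [],
                ell := tp (syms y).reverse [], clk := ck (query w (listWord x) y).length}
        (feedTapes true (syms (query w (listWord x) y)).reverse [])) h1
        fun _ => by simp [labStep]
      have h3 := reach_feedL (R := R) (O := O) (u := φ true x)
        {o with inp := tp (syms w).reverse [], els := tp (syms (listWord l)).reverse []} y []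
        (syms (query w (listWord x) [])).reverse (query w (listWord x) []).length
        (by simpa [query, add_assoc, add_comm, add_left_comm] using h2)
      refine (reach_step h3 fun _ => ?_).mono_time ?_
      · simp [labStep, moveHead, Acts.feed, query]
        congr 3
        ring
      · simp
        omega
    | false =>
      have h1 := reach_rewX (R := R) (O := O) (T := T) (u := φ false x)
        {o with clk := ck (query w (listWord x) []).length} w (listWord l) [] y
        (query w (listWord x) []) (by simpa using hx)
      have h2 := reach_step (q := .feedL false) (t := join
        {o with inp := tp (syms w).reverse [], els := tp (syms (listWord l)).reverse [],
                ell := tp [] (syms y), clk := ck (query w (listWord x) []).length}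
        (feedTapes true (syms (query w (listWord x) [])).reverse [])) h1
        fun _ => by simp [labStep]
      refine (reach_step h2 fun _ => ?_).mono_time ?_
      · simp [labStep, moveHead, Acts.feed, query]
        congr 3
        ring
      · simp [query]
        omega
  rw [← feedTapes_nil true]
  refine (reach_feedB (T := T + (2 * w.length + 2 * (listWord l).length + 3 * y.length + 12) +
        3 * (listWord l).length + 1) true
    {o with els := tp [] (syms (listWord l)), ell := tp [] (syms y)} w [] [] 0 ?_).mono_time
    (by omega)
  refine reach_flip (u := fun t => avg t (φ t) l) (q' := fun t => .inl (.pick t)) key rfl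
    fun _ => ?_
  simp [labStep, moveHead, Acts.feed]

/-! ### Cleaning the tapes of the subroutines -/

theorem reach_clean₃ (k : Bool) (o : OwnTapes N B) (K : ℕ) (s : Sub N → Turing.Tape (Sy N B))
    (hi : ℤ) (hK : hi ≤ K) (hs : ∀ j, BlankOutside (s j) 0 hi)
    (h : (machine N B d).Reach O R T (conf (.inl (.clean₃ k)) {o with clk := ck 0}
      (fun _ => tp [] [])) u) :
    (machine N B d).Reach O R (T + K) (conf (.inl (.clean₃ k))
      {o with clk := (ck K).move .left} s) u := by
  induction K generalizing hi s with
  | zero =>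
    rw [show s = fun _ => tp [] [] from funext fun j => (hs j).eq_blank (by simpa using hK)]
    simpa [ck] using h
  | succ K ih =>
    refine reach_step (ih (fun j => ((s j).write default).move .right) (hi - 1)
      (by push_cast at hK; omega) fun j => (hs j).erase_right) fun _ => ?_
    have e : (ck (K + 1) : Turing.Tape (Sy N B)).move .left = tp (List.replicate K mark) [mark] := by
      simp [ck, List.replicate_succ]
    have e' : (ck K : Turing.Tape (Sy N B)).move .left =
        (tp (List.replicate K mark) [none]).move .left := by
      simp [ck]
    rw [e, e']
    exact ⟨by simp [labStep], by simp [labStep, moveHead]; rfl⟩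

theorem reach_clean₂ (k : Bool) (o : OwnTapes N B) (K i j : ℕ) (s : Sub N → Turing.Tape (Sy N B))
    (hK : i + j = K) (hs : ∀ x, BlankOutside (s x) 0 (K + 1 + j))
    (h : (machine N B d).Reach O R T (conf (.inl (.clean₃ k)) {o with clk := ck 0}
      (fun _ => tp [] [])) u) :
    (machine N B d).Reach O R (T + K + 1 + j) (conf (.inl (.clean₂ k))
      {o with clk := tp (List.replicate i mark) (List.replicate j mark)} s) u := by
  induction j generalizing i s with
  | zero =>
    obtain rfl : i = K := by omega
    refine reach_step (reach_clean₃ k o i (fun x => ((s x).write default).move .right) i le_rfl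
      (fun x => ((hs x).erase_right).mono le_rfl (by push_cast; omega)) h) fun _ => ?_
    have e' : (ck i : Turing.Tape (Sy N B)).move .left =
        (tp (List.replicate i mark) [none]).move .left := by
      simp [ck]
    rw [e']
    exact ⟨by simp [labStep], by simp [labStep, moveHead]; rfl⟩
  | succ j ih =>
    refine reach_step (ih (i + 1) (fun x => ((s x).write default).move .right) (by omega)
      fun x => ((hs x).erase_right).mono le_rfl (by push_cast; omega)) fun _ => ?_
    rw [List.replicate_succ, List.replicate_succ]
    exact ⟨by simp [labStep], by simp [labStep, moveHead]; rfl⟩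

theorem reach_clean₁ (k : Bool) (o : OwnTapes N B) (K i j : ℕ) (s : Sub N → Turing.Tape (Sy N B))
    (hK : i + j = K) (hs : ∀ x, BlankOutside (s x) (-i) (K + 1 + j))
    (h : (machine N B d).Reach O R T (conf (.inl (.clean₃ k)) {o with clk := ck 0}
      (fun _ => tp [] [])) u) :
    (machine N B d).Reach O R (T + 2 * K + 2 + i) (conf (.inl (.clean₁ k))
      {o with clk := (tp (List.replicate i mark) (List.replicate j mark)).move .left} s) u := by
  induction i generalizing j s with
  | zero =>
    obtain rfl : j = K := by omega
    refine (reach_step (reach_clean₂ k o j 0 j s (by omega)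
      (fun x => (hs x).mono (by simp) le_rfl) h) fun _ => ?_).mono_time (by omega)
    simp [labStep, moveHead]
  | succ i ih =>
    refine reach_step (ih (j + 1) (fun x => (s x).move .left) (by omega)
      fun x => ((hs x).left).mono (by push_cast; omega) (by push_cast; omega)) fun _ => ?_
    rw [List.replicate_succ, List.replicate_succ]
    exact ⟨by simp [labStep], by simp [labStep, moveHead]⟩

/-- All heads go `K` cells to the left, in step with the clock head, and so reach the left end of
the window. Then the clock is traversed twice, to the right and back, while the other tapes are
erased to the right. The two passes and the turning point cover `2 * K + 1` cells, the whole window;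
the second pass also erases the clock. -/
theorem reach_clean (k : Bool) (o : OwnTapes N B) (K : ℕ) (s : Sub N → Turing.Tape (Sy N B))
    (hs : ∀ x, BlankOutside (s x) (-K) (K + 1))
    (h : (machine N B d).Reach O R T (conf (.inl (.clean₃ k)) {o with clk := ck 0}
      (fun _ => tp [] [])) u) :
    (machine N B d).Reach O R (T + 3 * K + 3) (conf (.inl (.clean₀ k)) {o with clk := ck K} s) u := by
  refine (reach_step (reach_clean₁ k o K K 0 s (by omega) (by simpa using hs) h)
    fun _ => ?_).mono_time (by omega)
  refine ⟨by simp [labStep], ?_⟩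
  have e : (ck K : Turing.Tape (Sy N B)).write none = ck K := by
    simpa using Turing.Tape.write_self (ck K : Turing.Tape (Sy N B))
  simp [labStep, moveHead, e]
  rfl

/-! ### Reading the ground set -/

/-- The number of commas in a word. -/
def commas : Word → ℕ
  | [] => 0
  | .comma :: w => commas w + 1
  | _ :: w => commas w

theorem commas_listWord (l : List Elt) : commas (listWord l) = l.length := by
  induction l with
  | nil => rfl
  | cons e l ih =>
    rw [listWord_cons, List.length_cons, ← ih]
    induction e with
    | nil => rfl
    | cons b e ih => exact ih

/-- One zero is put on the trial counter for every comma, that is, for every element, and one more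
at the end. The clock keeps ticking because the head of the output tape moves. -/
theorem reach_copyE (o : OwnTapes N B) (w : Word) (p c : List (Sy N B)) (n : ℕ)
    (s : Sub N → Turing.Tape (Sy N B)) (hs : ∀ x, BlankOutside (s x) (-n) (n + 1))
    (hw : ∀ (i : ℕ) (h : i < w.length),
      (s (place false (N false).outputTape)).nth i = lt w[i])
    (hw' : (s (place false (N false).outputTape)).nth w.length = none)
    (h : ∀ s' : Sub N → Turing.Tape (Sy N B),
      (∀ x, BlankOutside (s' x) (-(n + w.length : ℕ)) ((n + w.length : ℕ) + 1)) →
      (machine N B d).Reach O R T (conf (.inl (.clean₀ false))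
      {o with els := tp ((syms w).reverse ++ p) [],
              ctr := tp (List.replicate (commas w + 1) (lt (.bit false)) ++ c) [],
              clk := ck (n + w.length)} s') u) :
    (machine N B d).Reach O R (T + w.length + 1) (conf (.inl .copyE)
      {o with els := tp p [], ctr := tp c [], clk := ck n} s) u := by
  induction w generalizing p c n s with
  | nil =>
    have e : (s (place false (N false).outputTape)).head = none := hw'
    refine reach_step (h s (by simpa using hs)) fun _ => ?_
    simp [labStep, moveHead, e, commas]
  | cons a w ih =>
    have e : (s (place false (N false).outputTape)).head = lt a := hw 0 (by simp)
    have key := ih (lt a :: p)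
      (match a with | .comma => lt (.bit false) :: c | _ => c) (n + 1)
      (Function.update s (place false (N false).outputTape)
        ((s (place false (N false).outputTape)).move .right)) ?_ ?_ ?_ ?_
    · refine reach_step key fun _ => ?_
      have e' : (s (place false (N false).outputTape)).write (lt a) =
          s (place false (N false).outputTape) := by rw [← e, Turing.Tape.write_self]
      rcases a with a | _ | _ | _ <;> simp [labStep, moveHead, e, e']
    · intro x
      by_cases hx : x = place false (N false).outputTape
      · subst hx
        rw [Function.update_self]
        have := (hs (place false (N false).outputTape)).step (lt a) (some .right)
        rwa [moveHead, ← e, Turing.Tape.write_self] at this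
      · rw [Function.update_of_ne hx]
        exact (hs x).mono (by push_cast; omega) (by push_cast; omega)
    · intro i hi
      rw [Function.update_self, Turing.Tape.move_right_nth]
      exact hw (i + 1) (by simpa using hi)
    · rw [Function.update_self, Turing.Tape.move_right_nth]
      exact hw'
    · intro s' hs'
      have := h s' (by simpa [add_assoc, add_comm 1] using hs')
      rcases a with a | _ | _ | _ <;>
        simpa [add_assoc, add_comm 1, commas, List.replicate_succ'] using this

/-! ### Binary counters -/

/-- Increment of a binary number, with the least significant bit first. -/
def binc : List Bool → List Bool
  | [] => [true]
  | false :: c => true :: c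
  | true :: c => false :: binc c

theorem encodePosNum_succ (n : PosNum) :
    Computability.encodePosNum n.succ = binc (Computability.encodePosNum n) := by
  induction n with
  | one => rfl
  | bit0 n _ => rfl
  | bit1 n ih => exact congrArg _ ih

/-- Hence the extension size can be kept and incremented on its tape in exactly the format in which
the extension algorithm expects it. -/
theorem encodeNat_succ (n : ℕ) :
    Computability.encodeNat (n + 1) = binc (Computability.encodeNat n) := by
  unfold Computability.encodeNat
  rw [Nat.cast_add, Nat.cast_one, Num.add_one]
  cases (n : Num) with
  | zero => rfl
  | pos p => exact encodePosNum_succ p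

theorem encodeNat_length_le (n : ℕ) : (Computability.encodeNat n).length ≤ n := by
  have h : ∀ c, (binc c).length ≤ c.length + 1 := by
    intro c
    induction c with
    | nil => simp [binc]
    | cons b c ih => cases b <;> simp [binc]; exact ih
  induction n with
  | zero => simp [Computability.encodeNat, Computability.encodeNum]
  | succ n ih => rw [encodeNat_succ]; exact (h _).trans (by omega)

theorem reach_incL (o : OwnTapes N B) (s : Sub N → Turing.Tape (Sy N B)) (l c : List Bool)
    (h : (machine N B d).Reach O R T (conf (.inl .count)
      {o with ell := tp [] (bits (l ++ binc c))} s) u) :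
    (machine N B d).Reach O R (T + (2 * c.length + l.length + 3)) (conf (.inl .incL)
      {o with ell := tp (bits l).reverse (bits c)} s) u := by
  induction c generalizing l with
  | nil =>
    refine (reach_step (reach_rew (T := T) .ell
      (join {o with ell := tp (bits l).reverse [lt (.bit true)]} s) (bits l).reverse [lt (.bit true)] rfl (by simp) ?_)
      fun _ => ?_).mono_time (by simp)
    · simpa [Rew.tape, Rew.next, binc] using h
    · simp [labStep, moveHead]
  | cons b c ih =>
    cases b with
    | false =>
      refine (reach_step (reach_rew (T := T) .ell
        (join {o with ell := tp (bits l).reverse (bits (true :: c))} s) (bits l).reverse _ rfl (by simp) ?_)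
        fun _ => ?_).mono_time (by simp)
      · simpa [Rew.tape, Rew.next, binc] using h
      · simp [labStep, moveHead]
    | true =>
      refine (reach_step (ih (l ++ [false]) ?_) fun _ => ?_).mono_time (by simp; omega)
      · simpa [bitsWord, binc] using h
      · simp [labStep, moveHead]

theorem reach_incC (o : OwnTapes N B) (s : Sub N → Turing.Tape (Sy N B)) (l c : List Bool)
    (hc : false ∈ c)
    (h : (machine N B d).Reach O R T (conf (.inl (.feedB true))
      {o with ctr := tp [] (bits (l ++ binc c))} s) u) :
    (machine N B d).Reach O R (T + (2 * c.length + l.length + 3)) (conf (.inl .incC)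
      {o with ctr := tp (bits l).reverse (bits c)} s) u := by
  induction c generalizing l with
  | nil => simp at hc
  | cons b c ih =>
    cases b with
    | false =>
      refine (reach_step (reach_rew (T := T) .ctr
        (join {o with ctr := tp (bits l).reverse (bits (true :: c))} s) (bits l).reverse _ rfl (by simp) ?_)
        fun _ => ?_).mono_time (by simp)
      · simpa [Rew.tape, Rew.next, binc] using h
      · simp [labStep, moveHead]
    | true =>
      refine (reach_step (ih (l ++ [false]) (by simpa using hc) ?_) fun _ => ?_).mono_time
        (by simp; omega)
      · simpa [bitsWord, binc] using h
      · simp [labStep, moveHead]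

theorem reach_incC_overflow (o : OwnTapes N B) (s : Sub N → Turing.Tape (Sy N B))
    (l : List (Sy N B)) (c : List Bool) (hc : false ∉ c)
    (h : ∀ l', (machine N B d).Reach O R T (conf (.inl .halt)
      {o with ctr := tp l' [], ans := tp [] [lt (.bit false)]} s) u) :
    (machine N B d).Reach O R (T + (c.length + 1)) (conf (.inl .incC)
      {o with ctr := tp l (bits c), ans := tp [] []} s) u := by
  induction c generalizing l with
  | nil =>
    refine reach_step (h l) fun _ => ?_
    simp [labStep, moveHead]
  | cons b c ih =>
    cases b with
    | false => simp at hc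
    | true =>
      refine reach_step (ih (lt (.bit false) :: l) (by simpa using hc)) fun _ => ?_
      simp [labStep, moveHead]

/-! ### Counting the elements -/

/-- Increment of a number to base `B + 2`, with the least significant digit first. -/
def zinc : List (Fin (B + 2)) → List (Fin (B + 2))
  | [] => [1]
  | i :: c => if h : i.val + 1 < B + 2 then ⟨i + 1, h⟩ :: c else 0 :: zinc c

abbrev digs (c : List (Fin (B + 2))) : List (Sy N B) := c.map dig

/-- The trial counter with `a + 1` zeros; the head is on the last one. -/
def zeros (a : ℕ) : Turing.Tape (Sy N B) :=
  tp (List.replicate a (lt (.bit false))) [lt (.bit false)]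

theorem zeros_erase (a : ℕ) :
    ((zeros (a + 1) : Turing.Tape (Sy N B)).write none).move .left = zeros a := by
  simp [zeros, List.replicate_succ]

theorem reach_drop (o : OwnTapes N B) (s : Sub N → Turing.Tape (Sy N B)) (a i : ℕ) (hi : i < d + 1)
    (h : (machine N B d).Reach O R T (conf (.inl (.drop 0)) {o with ctr := zeros a} s) u) :
    (machine N B d).Reach O R (T + i) (conf (.inl (.drop ⟨i, hi⟩))
      {o with ctr := zeros (a + i)} s) u := by
  induction i with
  | zero => exact h
  | succ i ih =>
    refine reach_step (ih (by omega)) fun _ => ?_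
    rw [← add_assoc]
    simp [labStep, moveHead, zeros_erase]

/-- The head of the digit tape walks back over the old digits, and `reach_drop` is run once per
digit: this multiplies `d` by the number of digits without any arithmetic on the machine. -/
theorem reach_growth (o : OwnTapes N B) (s : Sub N → Turing.Tape (Sy N B)) (a : ℕ)
    (l r : List (Sy N B)) (hl : none ∉ l)
    (h : (machine N B d).Reach O R T (conf (.inl .incL)
      {o with ctr := zeros a, z := tp [] (l.reverse ++ r)} s) u) :
    (machine N B d).Reach O R (T + (l.length * (d + 1) + 1)) (conf (.inl (.drop 0))
      {o with ctr := zeros (a + d * l.length), z := (tp l r).move .left} s) u := by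
  induction l generalizing r with
  | nil =>
    refine (reach_step h fun _ => ?_).mono_time (by omega)
    simp [labStep, moveHead]
  | cons x l ih =>
    obtain _ | x := x
    · simp at hl
    have h1 := ih (some x :: r) (by simpa using hl) (by simpa using h)
    have h2 := reach_drop {o with z := (tp l (some x :: r)).move .left} s (a + d * l.length) d
      (by omega) h1
    refine (reach_step h2 fun _ => ?_).mono_time (by rw [List.length_cons]; linarith)
    simp [labStep, moveHead, Fin.last, mul_add, add_assoc]

/-- All digits are maximal. -/
def Full (c : List (Fin (B + 2))) : Prop := ∀ i ∈ c, ¬ i.val + 1 < B + 2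

theorem reach_incZ (o : OwnTapes N B) (s : Sub N → Turing.Tape (Sy N B))
    (l c : List (Fin (B + 2))) (hc : ¬ Full c)
    (h : (machine N B d).Reach O R T (conf (.inl .count)
      {o with z := tp [] (digs (l ++ zinc c))} s) u) :
    (machine N B d).Reach O R (T + (2 * c.length + l.length + 3)) (conf (.inl .incZ)
      {o with z := tp (digs l).reverse (digs c)} s) u := by
  induction c generalizing l with
  | nil => simp [Full] at hc
  | cons i c ih =>
    by_cases hi : i.val + 1 < B + 2
    · refine (reach_step (reach_rew (T := T) .z
        (join {o with z := tp (digs l).reverse (digs (⟨i + 1, hi⟩ :: c))} s) (digs l).reverse _ rfl (by simp) ?_)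
        fun _ => ?_).mono_time (by simp)
      · simpa [Rew.tape, Rew.next, zinc, hi] using h
      · simp only [labStep, join_z, List.map_cons, tp_head_cons, dif_pos hi]
        simp [moveHead]
    · refine (reach_step (ih (l ++ [0]) ?_ ?_) fun _ => ?_).mono_time
        (by simp; omega)
      · refine fun hf => hc fun j hj => ?_
        rcases List.mem_cons.1 hj with rfl | hj
        exacts [hi, hf j hj]
      · simpa [zinc, hi] using h
      · simp only [labStep, join_z, List.map_cons, tp_head_cons, dif_neg hi]
        simp [moveHead]

theorem reach_incZ_growth (o : OwnTapes N B) (s : Sub N → Turing.Tape (Sy N B)) (a : ℕ)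
    (l c : List (Fin (B + 2))) (hc : Full c)
    (h : (machine N B d).Reach O R T (conf (.inl .incL)
      {o with ctr := zeros a, z := tp [] (digs (l ++ zinc c))} s) u) :
    (machine N B d).Reach O R (T + ((l.length + c.length) * (d + 1) + c.length + 2))
      (conf (.inl .incZ)
      {o with ctr := zeros (a + d * (l.length + c.length)), z := tp (digs l).reverse (digs c)} s)
        u := by
  induction c generalizing l with
  | nil =>
    refine (reach_step (reach_growth o s a (digs l).reverse [dig 1] (by simp) ?_)
      fun _ => ?_).mono_time (t := T + ((digs l : List (Sy N B)).reverse.length * (d + 1) + 1) + 1)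
      (by simp)
    · simpa [zinc] using h
    · simp [labStep, moveHead]
  | cons i c ih =>
    have hi : ¬ i.val + 1 < B + 2 := hc i (by simp)
    refine (reach_step (ih (l ++ [0]) (fun j hj => hc j (by simp [hj])) ?_)
      fun _ => ?_).mono_time ?_
    · simpa [zinc, hi] using h
    · simp only [labStep, join_z, List.map_cons, tp_head_cons, dif_neg hi]
      simp [moveHead]
      congr 3
      ring
    · simp only [List.length_append, List.length_cons, List.length_nil]
      linarith

/-! ### Running a subroutine -/

/-- The translation of the symbols, as a map that respects the blank. -/
noncomputable def encMap (k : Bool) : Turing.PointedMap (N k).Γ (Sy N B) :=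
  ⟨enc k, enc_default k⟩

theorem encMap_apply (k : Bool) (x : (N k).Γ) : encMap (B := B) k x = enc k x := rfl

theorem tape_map_nth {Γ Γ' : Type} [Inhabited Γ] [Inhabited Γ'] (f : Turing.PointedMap Γ Γ')
    (t : Turing.Tape Γ) (i : ℤ) : (t.map f).nth i = f (t.nth i) := by
  match i with
  | 0 => exact Turing.Tape.map_fst f t
  | (n + 1 : ℕ) => exact Turing.ListBlank.nth_map f t.right n
  | Int.negSucc n => exact Turing.ListBlank.nth_map f t.left n

theorem enc_eq_sym (k : Bool) (x : (N k).Γ) (a : Letter) :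
    enc (B := B) k x = lt a ↔ x = (N k).sym a := by
  rw [← enc_sym k, (enc_injective k).eq_iff]

theorem enc_eq_none (k : Bool) (x : (N k).Γ) : enc (B := B) k x = none ↔ x = default := by
  rw [← (enc_injective (B := B) k).eq_iff, enc_default]
  rfl

/-- The translation of symbols is injective and matches letters with letters and blank with blank.
Therefore queries and outputs keep their meaning, and the oracle answers a simulated query as it
would answer the subroutine. -/
theorem shows_map (k : Bool) (t : Turing.Tape (N k).Γ) (w : Word) :
    (machine N B d).Shows (t.map (encMap k)) w ↔ (N k).Shows t w := by
  unfold OracleMachine.Shows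
  refine and_congr (forall_congr' fun i => forall_congr' fun h => ?_) ?_
  · erw [tape_map_nth]
    exact enc_eq_sym k _ _
  · erw [tape_map_nth]
    exact enc_eq_none k _

/-- The tapes `s` represent the configuration `c` of subroutine `k`. -/
def Represents (k : Bool) (s : Sub N → Turing.Tape (Sy N B)) (c : (N k).Cfg) : Prop :=
  ∀ i, s (place k i) = (c.tape i).map (encMap k)

theorem answer_state (k : Bool) (o : OwnTapes N B) (s : Sub N → Turing.Tape (Sy N B))
    (c : (N k).Cfg) (hs : Represents k s c) :
    ((N k).answer O c).state = (N k).yes ∧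
      (machine N B d).answer O (conf (.inl .ask) o s) = conf (.inl .yes) o s ∨
    ((N k).answer O c).state = (N k).no ∧
      (machine N B d).answer O (conf (.inl .ask) o s) = conf (.inl .no) o s := by
  have e : (conf (.inl .ask) o s : (machine N B d).Cfg).tape (machine N B d).queryTape =
      (c.tape (N k).queryTape).map (encMap k) := by
    rw [← hs, place_query]
    rfl
  have e' : ∀ w, (machine N B d).Shows ((conf (.inl .ask) o s : (machine N B d).Cfg).tape
      (machine N B d).queryTape) w ↔ (N k).Shows (c.tape (N k).queryTape) w := fun w => by
    rw [e]
    exact shows_map k _ w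
  unfold OracleMachine.answer
  by_cases h : ∃ w ∈ O, (N k).Shows (c.tape (N k).queryTape) w
  · refine Or.inl ⟨if_pos h, ?_⟩
    rw [if_pos (h.imp fun w hw => ⟨hw.1, (e' w).2 hw.2⟩)]
    rfl
  · refine Or.inr ⟨if_neg h, ?_⟩
    rw [if_neg (fun h' => h (h'.imp fun w hw => ⟨hw.1, (e' w).1 hw.2⟩))]
    rfl

theorem reach_ask (k : Bool) (o : OwnTapes N B) (n : ℕ) (s : Sub N → Turing.Tape (Sy N B))
    (c : (N k).Cfg) (hs : Represents k s c) (hc : c.state ≠ (N k).halt)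
    (hc' : c.state = (N k).ask)
    (h : (machine N B d).Reach O R T (conf (.inr ⟨k, ((N k).answer O c).state⟩)
      {o with clk := ck (n + 1)} s) u) :
    (machine N B d).Reach O R (T + 3) (conf (.inr ⟨k, c.state⟩) {o with clk := ck n} s) u := by
  have e0 : ((ck n : Turing.Tape (Sy N B)).write (lt (.bit k))) =
      tp (List.replicate n mark) [lt (.bit k)] := by simp [ck]
  have e2 : (tp (mark :: List.replicate n mark) [] : Turing.Tape (Sy N B)) = ck (n + 1) := by
    simp [ck, List.replicate_succ]
  refine .step (c' := conf (.inl .ask)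
    {o with clk := tp (List.replicate n mark) [lt (.bit k)]} s)
    (fun h => by cases h) (fun h => by cases h) (fun b => ?_) ?_
  · rw [act_sub, subStep, if_neg hc, if_pos hc']
    simp [moveHead, e0]
  · refine .ask (fun h => by cases h) rfl ?_
    rcases answer_state (O := O) (d := d) k {o with clk := tp (List.replicate n mark) [lt (.bit k)]}
      s c hs with ⟨h1, h2⟩ | ⟨h1, h2⟩
    · rw [h2]
      rw [h1] at h
      refine reach_step h fun _ => ?_
      simp [labStep, moveHead, e2]
    · rw [h2]
      rw [h1] at h
      refine reach_step h fun _ => ?_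
      simp [labStep, moveHead, e2]

theorem act_subStep (k : Bool) (o : OwnTapes N B) (n : ℕ) (s : Sub N → Turing.Tape (Sy N B))
    (c : (N k).Cfg) (hs : Represents k s c) (hc : c.state ≠ (N k).halt)
    (hc' : c.state ≠ (N k).ask) (hb : ∀ x, BlankOutside (s x) (-n) (n + 1)) (b : Bool) :
    ∃ s', (machine N B d).act (conf (.inr ⟨k, c.state⟩) {o with clk := ck n} s) b =
        conf (.inr ⟨k, ((N k).act c b).state⟩) {o with clk := ck (n + 1)} s' ∧
      Represents k s' ((N k).act c b) ∧
      ∀ x, BlankOutside (s' x) (-(n + 1 : ℕ)) ((n + 1 : ℕ) + 1) := by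
  have hr : (fun i => dec k (s (place k i)).head) = fun i => (c.tape i).head := by
    funext i
    rw [hs i, Turing.Tape.map_fst, encMap_apply, dec_enc]
  let f : Sub N → Sy N B × Option Turing.Dir := Function.extend (place k)
    (fun i => (enc k (((N k).δ c.state (fun i => (c.tape i).head) b).2 i).1,
      (((N k).δ c.state (fun i => (c.tape i).head) b).2 i).2)) fun j => ((s j).head, none)
  refine ⟨fun j => moveHead (f j).2 ((s j).write (f j).1), ?_, ?_, ?_⟩
  · rw [act_sub, subStep, if_neg hc, if_neg hc']
    simp only [join_sub, hr, applyActs_subs, Acts.own, applyActs_on, applyActs_keep, update_clk,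
      setSubs_join, join_clk, moveHead, ck_tick]
    rfl
  · intro i
    simp only [f, (place_injective k).extend_apply]
    rw [hs i]
    simp only [OracleMachine.act]
    rcases ((N k).δ c.state (fun i => (c.tape i).head) b).2 i with ⟨x, _ | m⟩
    · simp [moveHead, Turing.Tape.map_write, encMap_apply]
    · simp [moveHead, Turing.Tape.map_write, Turing.Tape.map_move, encMap_apply]
  · intro x
    exact (hb x).step _ _

/-- Induction on the derivation of `Reach` for the subroutine. An ordinary step is simulated by one
step with the same random bit, a query by three, whence the factor 3; the clock ticks once in either
case. -/
theorem reach_sim (k : Bool) (o : OwnTapes N B) {R' : (N k).Cfg → ℝ → Prop} {t : ℕ}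
    {c : (N k).Cfg} (hr : (N k).Reach O R' t c u) (n : ℕ) (s : Sub N → Turing.Tape (Sy N B))
    (hs : Represents k s c) (hb : ∀ x, BlankOutside (s x) (-n) (n + 1))
    (h : ∀ c' u' n' s', n' ≤ n + t → R' c' u' → Represents k s' c' →
      (∀ x, BlankOutside (s' x) (-n') (n' + 1)) →
      (machine N B d).Reach O R T (conf (.inr ⟨k, c'.state⟩) {o with clk := ck n'} s') u') :
    (machine N B d).Reach O R (T + 3 * t) (conf (.inr ⟨k, c.state⟩) {o with clk := ck n} s) u := by
  induction hr generalizing n s with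
  | here hR => exact (h _ _ n s (by omega) hR hs hb).mono_time (by omega)
  | @ask t c u h1 h2 _ ih =>
    refine (reach_ask k o n s c hs h1 h2 (ih (n + 1) s hs (fun x => (hb x).mono (by push_cast; omega)
      (by push_cast; omega)) fun c' u' n' s' hn' => h c' u' n' s' (by omega))).mono_time (by omega)
  | @flip t c u u₁ u₀ h1 h2 _ _ h3 ih1 ih0 =>
    have key : ∀ b v, (∀ (n : ℕ) s, Represents k s ((N k).act c b) →
        (∀ x, BlankOutside (s x) (-n) (n + 1)) →
        (∀ c' u' n' s', n' ≤ n + t → R' c' u' → Represents k s' c' →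
      (∀ x, BlankOutside (s' x) (-n') (n' + 1)) →
      (machine N B d).Reach O R T (conf (.inr ⟨k, c'.state⟩) {o with clk := ck n'} s') u') →
      (machine N B d).Reach O R (T + 3 * t)
        (conf (.inr ⟨k, ((N k).act c b).state⟩) {o with clk := ck n} s) v) →
      (machine N B d).Reach O R (T + 3 * t) ((machine N B d).act
        (conf (.inr ⟨k, c.state⟩) {o with clk := ck n} s) b) v := by
      intro b v ih
      obtain ⟨s', e, hs', hb'⟩ := act_subStep (d := d) k o n s c hs h1 h2 hb b
      rw [e]
      exact ih (n + 1) s' hs' hb' fun c' u' n' s' hn' => h c' u' n' s' (by omega)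
    exact (OracleMachine.Reach.flip (fun h => by cases h) (fun h => by cases h) (key true u₁ ih1)
      (key false u₀ ih0) h3).mono_time (by omega)

theorem represents_init (k : Bool) (w : Word) :
    Represents k (feedTapes (B := B) k [] (syms w)) ((N k).init w) := by
  intro i
  simp only [OracleMachine.init]
  by_cases h : i = (N k).inputTape
  · subst h
    rw [feedTapes_self, if_pos rfl, Turing.Tape.map_mk₁, List.map_map]
    have e : (encMap (B := B) k : (N k).Γ → Sy N B) ∘ (N k).sym = lt := funext (enc_sym k)
    rw [e]
    rfl
  · rw [feedTapes, Function.update_of_ne (fun e => h (place_injective k e)), if_neg h,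
      Turing.Tape.map_mk₁]
    rfl

theorem blankOutside_feedTapes (k : Bool) (w : Word) (x : Sub N) :
    BlankOutside (feedTapes (B := B) k [] (syms w) x) (-w.length) (w.length + 1) := by
  by_cases h : x = place k (N k).inputTape
  · subst h
    rw [feedTapes_self]
    exact .tp_nil (by simp)
  · rw [feedTapes, Function.update_of_ne h]
    exact .tp_nil (by simp)

theorem shows_out {k : Bool} {s : Sub N → Turing.Tape (Sy N B)} {c : (N k).Cfg}
    (hs : Represents k s c) {w : Word} (hw : (N k).Shows (c.tape (N k).outputTape) w) :
    (∀ (i : ℕ) (h : i < w.length), (s (place k (N k).outputTape)).nth i = lt w[i]) ∧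
      (s (place k (N k).outputTape)).nth w.length = none := by
  rw [hs]
  refine ⟨fun i h => ?_, ?_⟩
  · rw [tape_map_nth, hw.1 i h]
    exact enc_sym k _
  · rw [tape_map_nth, hw.2]
    exact enc_default k

/-- The probability that the output of subroutine `k` is not in `G`. -/
noncomputable def failProb (N : Bool → OracleMachine) (O : Set Word) (k : Bool) (w : Word) (t : ℕ)
    (G : Set Word) : ℝ :=
  (((N k).run O t ((N k).init w)).toOuterMeasure {c | ¬ (N k).HaltsIn G c}).toReal

theorem failProb_nonneg (k : Bool) (w : Word) (t : ℕ) (G : Set Word) :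
    0 ≤ failProb N O k w t G := ENNReal.toReal_nonneg

theorem failProb_le_one (k : Bool) (w : Word) (t : ℕ) (G : Set Word) :
    failProb N O k w t G ≤ 1 :=
  ENNReal.toReal_le_of_le_ofReal zero_le_one
    (by rw [ENNReal.ofReal_one]; exact OracleMachine.toOuterMeasure_le_one _ _)

theorem toOuterMeasure_add_compl {α : Type*} (p : PMF α) (A : Set α) :
    p.toOuterMeasure A + p.toOuterMeasure Aᶜ = 1 := by
  rw [PMF.toOuterMeasure_apply, PMF.toOuterMeasure_apply, ← ENNReal.tsum_add, ← p.tsum_coe]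
  exact tsum_congr fun a => congrFun (Set.indicator_self_add_compl A p) a

theorem failProb_le_half (k : Bool) (w : Word) (t : ℕ) (G : Set Word)
    (h : 1 / 2 ≤ (N k).prob O w t G) : failProb N O k w t G ≤ 1 / 2 := by
  have h1 := toOuterMeasure_add_compl ((N k).run O t ((N k).init w)) {c | (N k).HaltsIn G c}
  have h2 : (((N k).run O t ((N k).init w)).toOuterMeasure {c | (N k).HaltsIn G c}).toReal +
      failProb N O k w t G = 1 := by
    rw [failProb, ← ENNReal.toReal_one, ← h1, ENNReal.toReal_add]
    · rfl
    · exact ((OracleMachine.toOuterMeasure_le_one _ _).trans_lt ENNReal.one_lt_top).ne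
    · exact ((OracleMachine.toOuterMeasure_le_one _ _).trans_lt ENNReal.one_lt_top).ne
  have h3 : (1 / 2 : ENNReal).toReal ≤
      (((N k).run O t ((N k).init w)).toOuterMeasure {c | (N k).HaltsIn G c}).toReal :=
    ENNReal.toReal_mono
      ((OracleMachine.toOuterMeasure_le_one _ _).trans_lt ENNReal.one_lt_top).ne h
  norm_num at h3
  linarith

/-- Running a subroutine that always halts with an output in `A`. -/
theorem reach_run (k : Bool) (o : OwnTapes N B) (w : Word) (t : ℕ) (A G : Set Word)
    (hA : (N k).Always O w t A) (a : ℝ) (ha : 0 ≤ a)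
    (h : ∀ n s v y, n ≤ w.length + t → (∀ x, BlankOutside (s x) (-n) (n + 1)) →
      (∀ (i : ℕ) (h : i < y.length), (s (place k (N k).outputTape)).nth i = lt y[i]) →
      (s (place k (N k).outputTape)).nth y.length = none →
      0 ≤ v → (y ∈ G ∨ y ∈ A ∧ v = a) →
      (machine N B d).Reach O R T (conf (.inr ⟨k, (N k).halt⟩) {o with clk := ck n} s) v) :
    (machine N B d).Reach O R (T + 3 * t) (conf (.inr ⟨k, (N k).start⟩)
      {o with clk := ck w.length} (feedTapes k [] (syms w))) (failProb N O k w t G * a) := by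
  have h1 := OracleMachine.Reach.of_run (M := N k) (O := O) {c | (N k).HaltsIn A c}
    {c | ¬ (N k).HaltsIn G c} (fun c hc => hc.1) t ((N k).init w) hA
  -- The indicator of a bad output has expectation `failProb`; scaled by `a`, it charges a bad
  -- output with the value `a` of the continuation.
  have h2 := h1.scale (R' := fun c v => (N k).HaltsIn A c ∧ 0 ≤ v ∧ (¬ (N k).HaltsIn G c → v = a)) a
    fun c v hc => ⟨hc.1, mul_nonneg hc.2.1 ha, fun hG => by rw [hc.2.2 hG, one_mul]⟩
  refine reach_sim k o h2 w.length _ (represents_init k w) (blankOutside_feedTapes k w) ?_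
  rintro c v n s hn ⟨hc, hv, hv'⟩ hs hb
  rw [hc.1]
  by_cases hG : (N k).HaltsIn G c
  · obtain ⟨y, hy, hy'⟩ := hG.2
    exact h n s v y hn hb (shows_out hs hy').1 (shows_out hs hy').2 hv (Or.inl hy)
  · obtain ⟨y, hy, hy'⟩ := hc.2
    exact h n s v y hn hb (shows_out hs hy').1 (shows_out hs hy').2 hv (Or.inr ⟨hy, hv' hG⟩)

/-! ### Digit counts and the number of bits saved -/

theorem zinc_length_of_full {c : List (Fin (B + 2))} (h : Full c) :
    (zinc c).length = c.length + 1 := by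
  induction c with
  | nil => rfl
  | cons i c ih =>
    rw [zinc, dif_neg (h i (by simp)), List.length_cons, ih fun j hj => h j (by simp [hj])]
    rfl

theorem zinc_length_of_not_full {c : List (Fin (B + 2))} (h : ¬ Full c) :
    (zinc c).length = c.length := by
  induction c with
  | nil => simp [Full] at h
  | cons i c ih =>
    by_cases hi : i.val + 1 < B + 2
    · simp [zinc, hi]
    · rw [zinc, dif_neg hi, List.length_cons, ih]
      · rfl
      · refine fun hf => h fun j hj => ?_
        rcases List.mem_cons.1 hj with rfl | hj
        exacts [hi, hf j hj]

/-- The digits of `n` to base `B + 2`. -/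
def digits (B n : ℕ) : List (Fin (B + 2)) := zinc^[n] []

/-- The number of digits of `n` to base `B + 2`. -/
def lam (B n : ℕ) : ℕ := (digits B n).length

theorem digits_succ (n : ℕ) : digits B (n + 1) = zinc (digits B n) :=
  Function.iterate_succ_apply' _ _ _

theorem digits_zero : digits B 0 = [] := rfl

theorem lam_zero : lam B 0 = 0 := rfl

theorem encodeNat_zero : Computability.encodeNat 0 = [] := rfl

theorem lam_le_succ (n : ℕ) : lam B n ≤ lam B (n + 1) := by
  rw [lam, lam, digits_succ]
  by_cases h : Full (digits B n)
  · rw [zinc_length_of_full h]; omega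
  · rw [zinc_length_of_not_full h]

theorem lam_mono : Monotone (lam B) := monotone_nat_of_le_succ lam_le_succ

/-- The number of the bits of the trial counter that are dropped. -/
def saved (B d n : ℕ) : ℕ := d * (lam B n).choose 2

theorem saved_zero : saved B d 0 = 0 := rfl

theorem saved_mono : Monotone (saved B d) := fun _ _ h =>
  Nat.mul_le_mul_left d (Nat.choose_le_choose 2 (lam_mono h))

/-! ### Counting the elements -/

theorem reach_skipCount (o : OwnTapes N B) (s : Sub N → Turing.Tape (Sy N B)) (e : Elt)
    (p r : List (Sy N B))
    (h : (machine N B d).Reach O R T (conf (.inl .incZ)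
      {o with els := tp ((syms (eltWord e)).reverse ++ p) r} s) u) :
    (machine N B d).Reach O R (T + (e.length + 1)) (conf (.inl .count)
      {o with els := tp p (syms (eltWord e) ++ r)} s) u := by
  induction e generalizing p with
  | nil =>
    refine reach_step h fun _ => ?_
    simp [labStep, moveHead, eltWord_nil]
  | cons b e ih =>
    refine reach_step (ih (lt (.bit b) :: p) ?_) fun _ => ?_
    · simpa [eltWord_cons, add_assoc, add_comm 1] using h
    · simp [labStep, moveHead, eltWord_cons]

/-- The work tapes when `m` elements have been counted. -/
def counted (d X : ℕ) (o : OwnTapes N B) (m : ℕ) : OwnTapes N B :=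
  {o with
    ctr := zeros (X - saved B d m)
    z := tp [] (digs (digits B m))
    ell := tp [] (bits (Computability.encodeNat (lam B m)))}

/-- Pascal's rule: growth from λ to λ + 1 digits raises C(λ, 2) by λ, and exactly `d` zeros are
erased for each of the λ old digits. The bound `hX` keeps the truncated subtractions exact. -/
theorem reach_incr (X : ℕ) (o : OwnTapes N B) (s : Sub N → Turing.Tape (Sy N B)) (m : ℕ)
    (hX : saved B d (m + 1) ≤ X)
    (h : (machine N B d).Reach O R T (conf (.inl .count) (counted d X o (m + 1)) s) u) :
    (machine N B d).Reach O R (T + ((d + 4) * lam B m + 5))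
      (conf (.inl .incZ) (counted d X o m) s) u := by
  by_cases hf : Full (digits B m)
  · have hl : lam B (m + 1) = lam B m + 1 := by
      rw [lam, lam, digits_succ, zinc_length_of_full hf]
    have hs : saved B d (m + 1) = saved B d m + d * lam B m := by
      rw [saved, saved, hl, Nat.choose_succ_succ' (lam B m) 1, Nat.choose_one_right]
      ring
    have e : X - saved B d m = X - saved B d (m + 1) + d * ((([] : List (Fin (B + 2))).length) +
        (digits B m).length) := by
      rw [List.length_nil, zero_add]
      change _ = _ + d * lam B m
      omega
    have h1 := reach_incL (R := R) (O := O) (T := T) (u := u) (d := d)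
      {o with ctr := zeros (X - saved B d (m + 1)), z := tp [] (digs ([] ++ zinc (digits B m)))}
      s [] (Computability.encodeNat (lam B m))
      (by simpa [counted, ← encodeNat_succ, ← digits_succ, ← hl] using h)
    have h2 := reach_incZ_growth {o with ell := tp [] (bits (Computability.encodeNat (lam B m)))} s
      (X - saved B d (m + 1)) [] (digits B m) hf h1
    rw [← e] at h2
    refine h2.mono_time ?_
    have := encodeNat_length_le (lam B m)
    simp only [List.length_nil]
    change T + (2 * _ + 0 + 3) + ((0 + lam B m) * (d + 1) + lam B m + 2) ≤ _
    nlinarith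
  · have hl : lam B (m + 1) = lam B m := by
      rw [lam, lam, digits_succ, zinc_length_of_not_full hf]
    have hs : saved B d (m + 1) = saved B d m := by
      rw [saved, saved, hl]
    have h1 := reach_incZ (R := R) (O := O) (T := T) (u := u) (d := d)
      (counted d X o m) s [] (digits B m) hf
      (by simpa [counted, hs, hl, digits_succ] using h)
    refine h1.mono_time ?_
    simp only [List.length_nil]
    change T + (2 * lam B m + 0 + 3) ≤ _
    nlinarith

theorem reach_count (X : ℕ) (o : OwnTapes N B) (s : Sub N → Turing.Tape (Sy N B)) (l : List Elt)
    (p : List (Sy N B)) (m : ℕ) (hX : saved B d (m + l.length) ≤ X)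
    (h : (machine N B d).Reach O R T (conf (.inl .count)
      (counted d X {o with els := tp ((syms (listWord l)).reverse ++ p) []} (m + l.length)) s) u) :
    (machine N B d).Reach O R
      (T + ((listWord l).length + l.length * ((d + 4) * lam B (m + l.length) + 5)))
      (conf (.inl .count) (counted d X {o with els := tp p (syms (listWord l))} m) s) u := by
  induction l generalizing p m with
  | nil => simpa [listWord] using h
  | cons e l ih =>
    have el : m + (e :: l).length = m + 1 + l.length := by rw [List.length_cons]; omega
    rw [el] at hX h ⊢
    have h1 := ih ((syms (eltWord e)).reverse ++ p) (m + 1) hX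
      (by simpa [listWord_cons] using h)
    have h2 := reach_incr X _ s m ((saved_mono (by omega)).trans hX) h1
    have h3 := reach_skipCount (counted d X o m) s e p (syms (listWord l)) h2
    have hs : (syms (listWord (e :: l)) : List (Sy N B)) =
        syms (eltWord e) ++ syms (listWord l) := by
      simp [listWord_cons]
    rw [hs]
    refine h3.mono_time ?_
    have hm : lam B m ≤ lam B (m + 1 + l.length) := lam_mono (by omega)
    have hm' := Nat.mul_le_mul_left (d + 4) hm
    rw [listWord_cons, List.length_append, eltWord_length, List.length_cons, Nat.succ_mul l.length]
    omega

/-! ### The first stage -/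

/-- The work tapes at the beginning of a trial. -/
def main (w : Word) (l : List Elt) (c : List Bool) (z : Turing.Tape (Sy N B)) : OwnTapes N B where
  inp := tp [] (syms w)
  ctr := tp [] (bits c)
  z := z
  ell := tp [] (bits (Computability.encodeNat (lam B l.length)))
  els := tp [] (syms (listWord l))
  clk := ck 0
  ans := tp [] []

/-- The number of bits of the trial counter. -/
def width (B d n : ℕ) : ℕ := n + 2 - saved B d n

theorem reach_afterCopy (w : Word) (l : List Elt) (K : ℕ)
    (s : Sub N → Turing.Tape (Sy N B)) (hs : ∀ x, BlankOutside (s x) (-K) (K + 1))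
    (hl : saved B d l.length ≤ l.length)
    (h : (machine N B d).Reach O R T (conf (.inl (.feedB true))
      (main w l (List.replicate (width B d l.length) false) (tp [] (digs (digits B l.length))))
      (fun _ => tp [] [])) u) :
    (machine N B d).Reach O R
      (T + (3 * K + 3 * (listWord l).length + l.length * ((d + 4) * lam B l.length + 6) + 13))
      (conf (.inl (.clean₀ false))
      { inp := tp [] (syms w), ctr := tp (List.replicate (l.length + 2) (lt (.bit false))) [],
        z := tp [] [], ell := tp [] [], els := tp (syms (listWord l)).reverse [],
        clk := ck K, ans := tp [] [] } s) u := by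
  have hb : ∀ n, (bits (List.replicate n false) : List (Sy N B)) =
      List.replicate n (lt (.bit false)) := fun n => by simp [bits]
  have hw : width B d l.length = l.length + 1 - saved B d l.length + 1 := by
    rw [width]; omega
  set z : Turing.Tape (Sy N B) := tp [] (digs (digits B l.length)) with hz
  have h1 := reach_rew (R := R) (O := O) (T := T) (u := u) .ctr
    (join {(main w l [] z : OwnTapes N B) with ctr := zeros (l.length + 1 - saved B d l.length)}
      (fun _ => tp [] [])) (List.replicate (l.length + 1 - saved B d l.length) (lt (.bit false)))
      [lt (.bit false)] rfl (by simp [List.mem_replicate])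
      (by simpa [Rew.tape, Rew.next, main, hw, hb, List.replicate_succ'] using h)
  have h2 := reach_rew (R := R) (O := O) (u := u) (d := d) .elsEnd
    (join {(main w l [] z : OwnTapes N B) with
      ctr := zeros (l.length + 1 - saved B d l.length), els := tp (syms (listWord l)).reverse []}
      (fun _ => tp [] [])) (syms (listWord l)).reverse [] rfl (by simp)
      (by simpa [Rew.tape, Rew.next, main] using h1)
  have h3 := reach_step (q := .count) (t := join {(main w l [] z : OwnTapes N B) with
      ctr := zeros (l.length + 1 - saved B d l.length), els := tp (syms (listWord l)).reverse []}
      (fun _ => tp [] [])) h2 fun _ => by simp [labStep]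
  have h4 := reach_count (R := R) (O := O) (u := u) (d := d) (l.length + 1) (main w l [] z)
    (fun _ => tp [] []) l [] 0 (by rw [zero_add]; omega)
    (by simpa [counted, main, hz] using h3)
  have h5 := reach_rew (R := R) (O := O) (u := u) (d := d) .els
    (join {(main w [] [] (tp [] []) : OwnTapes N B) with
      ctr := zeros (l.length + 1), els := tp (syms (listWord l)).reverse []}
      (fun _ => tp [] [])) (syms (listWord l)).reverse [] rfl (by simp)
      (by simpa [Rew.tape, Rew.next, counted, main, digits_zero, lam_zero, saved_zero,
        encodeNat_zero] using h4)
  have h6 := reach_step (q := .clean₃ false) (t := join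
      {(main w [] [] (tp [] []) : OwnTapes N B) with
      ctr := tp (List.replicate (l.length + 2) (lt (.bit false))) [],
      els := tp (syms (listWord l)).reverse []} (fun _ => tp [] [])) h5 fun _ => by
    simp [labStep, moveHead, main, zeros, List.replicate_succ]
  have h7 := reach_clean (R := R) (O := O) (u := u) (d := d) false
    {(main w [] [] (tp [] []) : OwnTapes N B) with
      ctr := tp (List.replicate (l.length + 2) (lt (.bit false))) [],
      els := tp (syms (listWord l)).reverse []} K s hs h6
  have e0 : (bits (Computability.encodeNat (lam B 0)) : List (Sy N B)) = [] := rfl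
  have e1 : listWord [] = [] := rfl
  simp only [main, List.length_nil, lam_zero, e1, List.map_nil] at h7
  refine h7.mono_time ?_
  have e2 : l.length * ((d + 4) * lam B l.length + 6) =
    l.length * ((d + 4) * lam B l.length + 5) + l.length := Nat.mul_succ _ _
  simp only [List.length_reverse, List.length_map]
  omega

theorem failProb_empty (k : Bool) (w : Word) (t : ℕ) : failProb N O k w t ∅ = 1 := by
  have h : {c | ¬ (N k).HaltsIn ∅ c} = Set.univ := by
    ext c
    simp [OracleMachine.HaltsIn]
  rw [failProb, h, PMF.toOuterMeasure_apply, Set.indicator_univ, PMF.tsum_coe, ENNReal.toReal_one]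

theorem init_eq (w : Word) : (machine N B d).init w = conf (.inl (.feedB false))
    { inp := tp [] (syms w), ctr := tp [] [], z := tp [] [], ell := tp [] [], els := tp [] [],
      clk := ck 0, ans := tp [] [] } (fun _ => tp [] []) := by
  refine congrArg _ (funext fun i => ?_)
  rcases i with (_ | _) | _ <;> rfl

/-- An output cannot be longer than the window guaranteed by the clock. This bounds the word that
lists the ground set. -/
theorem length_le_of_blankOutside {t : Turing.Tape (Sy N B)} {n : ℕ} {y : Word}
    (ht : BlankOutside t (-n) (n + 1)) (hy : ∀ (i : ℕ) (h : i < y.length), t.nth i = lt y[i]) :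
    y.length ≤ n + 1 := by
  by_contra h
  push Not at h
  have h1 := hy (n + 1) h
  rw [ht _ (Or.inr (by push_cast; rfl))] at h1
  cases h1

/-- A bound on the time until the first trial starts. -/
def setupTime (B d A m : ℕ) : ℕ := 13 * A + m * ((d + 4) * lam B m + 6) + 27

theorem reach_setup (w : Word) (t : ℕ) (E : Finset Elt)
    (hE : (N false).Always O w t {y | IsSetWord y E}) (hs : saved B d E.card ≤ E.card)
    (hu : 0 ≤ u)
    (h : ∀ l : List Elt, l.Nodup → l.toFinset = E → (listWord l).length ≤ w.length + t + 1 →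
      (machine N B d).Reach O R T (conf (.inl (.feedB true))
      (main w l (List.replicate (width B d E.card) false) (tp [] (digs (digits B E.card))))
      (fun _ => tp [] [])) u) :
    (machine N B d).Reach O R (T + setupTime B d (w.length + t) E.card)
      ((machine N B d).init w) u := by
  rw [init_eq]
  -- With no outputs counted as good, `failProb` is 1, so the value `u` passes unchanged through the
  -- first subroutine.
  have h1 := reach_run (R := R) (O := O) (d := d) (T := T + (10 * (w.length + t) +
      E.card * ((d + 4) * lam B E.card + 6) + 22)) false
    { inp := tp [] (syms w), ctr := tp [lt (.bit false)] [], z := tp [] [], ell := tp [] [],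
      els := tp [] [], clk := ck 0, ans := tp [] [] } w t _ ∅ hE u hu ?_
  · rw [failProb_empty, one_mul] at h1
    refine (reach_startE (R := R) (O := O) (u := u) _ w [] h1).mono_time ?_
    rw [setupTime]
    omega
  · rintro n s v y hn hb hy hy' - (hG | ⟨⟨l, hl, hlE, rfl⟩, rfl⟩)
    · exact hG.elim
    have hc : E.card = l.length := by rw [← hlE, List.toFinset_card_of_nodup hl]
    have hlen := length_le_of_blankOutside (hb _) hy
    refine (OracleMachine.Reach.step (fun h => by cases h) (fun h => by cases h)
      (c' := conf (.inl .copyE)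
        { inp := tp [] (syms w), ctr := tp [lt (.bit false)] [], z := tp [] [], ell := tp [] [],
          els := tp [] [], clk := ck n, ans := tp [] [] } s)
      (fun b => ?_) (reach_copyE (main w [] [] (tp [] [])) (listWord l) [] [lt (.bit false)] n s hb hy hy'
        fun s' hs' => ?_) (t := T + (3 * (n + (listWord l).length) + 3 * (listWord l).length +
          l.length * ((d + 4) * lam B l.length + 6) + 13) + (listWord l).length + 1)).mono_time ?_
    · rw [act_sub, subStep, if_pos rfl]
      simp [subEnd]
    · have h2 := reach_afterCopy (R := R) (O := O) (d := d) w l (n + (listWord l).length) s' hs'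
        (hc ▸ hs) (hc ▸ h l hl hlE (by omega))
      have e : List.replicate (commas (listWord l) + 1) (lt (.bit false)) ++ [lt (.bit false)] =
          (List.replicate (l.length + 2) (lt (.bit false)) : List (Sy N B)) := by
        rw [commas_listWord, List.replicate_succ' (n := l.length + 1)]
      rw [e, List.append_nil]
      exact h2
    · rw [hc]
      omega

/-! ### Trials -/

theorem avg_mul (t : Bool) (φ : List Elt → ℝ) (v : ℝ) (l : List Elt) :
    avg t (fun x => φ x * v) l = avg t φ l * v := by
  induction l generalizing φ with
  | nil => simp [avg]
  | cons e l ih =>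
    have h := ih fun x => φ (e :: x)
    cases t <;> simp only [avg, if_true, Bool.false_eq_true, if_false] at h ⊢ <;> rw [h, ih φ] <;> ring

/-- The input of the second subroutine in a trial. -/
def trialInput (B : ℕ) (w : Word) (n : ℕ) (t : Bool) (x : List Elt) : Word :=
  query w (listWord x) (if t then natWord (lam B n) else [])

/-- The probability that a trial fails. -/
noncomputable def trialFail (N : Bool → OracleMachine) (O : Set Word) (B : ℕ) (w : Word)
    (l : List Elt) (tX : Bool → ℕ) (G : Bool → List Elt → Set Word) : ℝ :=
  (avg true (fun x => failProb N O true (trialInput B w l.length true x) (tX true) (G true x)) l +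
    avg false (fun x => failProb N O true (trialInput B w l.length false x) (tX false)
      (G false x)) l) / 2

theorem trialInput_length_le (w : Word) (t : Bool) {x l : List Elt} (h : x.Sublist l) :
    (trialInput B w l.length t x).length ≤
      w.length + (listWord l).length + lam B l.length + 2 := by
  have h1 := listWord_length_le h
  have h2 : (if t then natWord (lam B l.length) else []).length ≤ lam B l.length := by
    cases t
    · simp
    · simpa [natWord, bitsWord] using encodeNat_length_le (lam B l.length)
  simp only [trialInput, query, List.length_append, List.length_singleton]
  omega

/-- A success ends the computation in a configuration that is acceptable with any nonnegative value;
only a failure continues, with value `u`. The expectation is therefore the failure probability times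
`u`. -/
theorem reach_trial (w : Word) (l : List Elt) (c : List Bool) (z : Turing.Tape (Sy N B))
    (tX : Bool → ℕ) (τ : ℕ) (hτ : ∀ t, tX t ≤ τ) (G : Bool → List Elt → Set Word)
    (hA : ∀ t x, x.Sublist l →
      (N true).Always O (trialInput B w l.length t x) (tX t) ({[Letter.bot]} ∪ G t x))
    (hG : ∀ t x, x.Sublist l → ∀ y ∈ G t x, y.head? ≠ some Letter.bot)
    (hyes : ∀ t x, x.Sublist l → ∀ y ∈ G t x, ∀ (o : OwnTapes N B) s v, 0 ≤ v →
      R (conf (.inl .halt) {o with ans := tp [] [lt (.bit true)]} s) v)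
    (hu : 0 ≤ u)
    (hno : (machine N B d).Reach O R T (conf (.inl .incC) (main w l c z) fun _ => tp [] []) u) :
    (machine N B d).Reach O R
      (T + (8 * (w.length + (listWord l).length + lam B l.length) + 6 * τ + 24))
      (conf (.inl (.feedB true)) (main w l c z) fun _ => tp [] [])
      (trialFail N O B w l tX G * u) := by
  set A := w.length + (listWord l).length + lam B l.length with hAdef
  have hy : (syms (natWord (lam B l.length)) : List (Sy N B)) =
      bits (Computability.encodeNat (lam B l.length)) := syms_bitsWord _
  have h1 := reach_sample (R := R) (O := O) (d := d) (T := T + (3 * A + 6 * τ + 11))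
    (main w l c z) w (natWord (lam B l.length)) l (fun t x =>
      failProb N O true (trialInput B w l.length t x) (tX t) (G t x) * u) ?_
  · rw [avg_mul, avg_mul, hy] at h1
    have e : trialFail N O B w l tX G * u =
      (avg true (fun x => failProb N O true (trialInput B w l.length true x) (tX true)
        (G true x)) l * u + avg false (fun x => failProb N O true
        (trialInput B w l.length false x) (tX false) (G false x)) l * u) / 2 := by
      rw [trialFail]; ring
    rw [e]
    refine h1.mono_time ?_
    have : (natWord (lam B l.length)).length ≤ lam B l.length := by
      simpa [natWord, bitsWord] using encodeNat_length_le (lam B l.length)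
    omega
  · intro t x hx
    have hlen := trialInput_length_le (B := B) w t hx
    rw [hy]
    refine (reach_run (R := R) (O := O) (d := d) (T := T + (3 * A + 3 * τ + 11)) true
      (main w l c z) (trialInput B w l.length t x) (tX t) _ (G t x) (hA t x hx) u hu ?_).mono_time
      (by have := hτ t; omega)
    intro n s v y hn hb hsy hsy' hv hy
    have hn' : n ≤ A + 2 + τ := by have := hτ t; omega
    have halts : y ∈ G t x → (machine N B d).Reach O R (T + (3 * A + 3 * τ + 11))
        (conf (.inr ⟨true, (N true).halt⟩) {main w l c z with clk := ck n} s) v := by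
      intro hy
      have hd : (s (place true (N true).outputTape)).head ≠ lt .bot := by
        have h0 : (s (place true (N true).outputTape)).head =
          (s (place true (N true).outputTape)).nth 0 := rfl
        have h2 := hG t x hx y hy
        cases y with
        -- The empty set is a legitimate answer, written as the empty word; the blank cell then
        -- differs from `bot`.
        | nil =>
          intro h
          have h3 : (s (place true (N true).outputTape)).nth 0 = none := hsy'
          rw [← h0, h] at h3
          cases h3
        | cons a y =>
          have h3 : (s (place true (N true).outputTape)).nth 0 = lt a := hsy 0 (by simp)
          rw [h0, h3]
          simpa using h2
      refine (OracleMachine.Reach.step (fun h => by cases h) (fun h => by cases h)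
        (c' := conf (.inl .halt)
          {({main w l c z with clk := ck n} : OwnTapes N B) with ans := tp [] [lt (.bit true)]} s)
        (fun b => ?_) (.here (hyes t x hx y hy _ s v hv)) (t := 0)).mono_time (by omega)
      rw [act_sub, subStep, if_pos rfl]
      have e : (subEnd (d := d) (fun j => (join {main w l c z with clk := ck n} s j).head) true) =
          (.inl .halt, (keep fun j => (join {main w l c z with clk := ck n} s j).head).own .ans
            (lt (.bit true)) none) := by
        simp only [subEnd, join_sub]
      rw [e]
      simp [moveHead, main]
    rcases hy with hy | ⟨hy | hy, rfl⟩
    · exact halts hy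
    · subst hy
      have hd : (s (place true (N true).outputTape)).head = lt .bot := hsy 0 (by simp)
      refine (OracleMachine.Reach.step (fun h => by cases h) (fun h => by cases h)
        (c' := conf (.inl (.clean₀ true)) {main w l c z with clk := ck n} s)
        (fun b => ?_) (reach_clean true (main w l c z) n s hb
          (reach_step hno fun _ => by simp [labStep, main]))).mono_time (by omega)
      rw [act_sub, subStep, if_pos rfl]
      simp [subEnd, hd]
    · exact halts hy

/-! ### The loop -/

/-- The value of a binary counter. -/
def binVal : List Bool → ℕ
  | [] => 0
  | b :: c => b.toNat + 2 * binVal c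

theorem binVal_lt (c : List Bool) : binVal c < 2 ^ c.length := by
  induction c with
  | nil => simp [binVal]
  | cons b c ih =>
    have := b.toNat_le
    rw [binVal, List.length_cons, pow_succ]
    omega

theorem binVal_of_false_notMem {c : List Bool} (h : false ∉ c) : binVal c + 1 = 2 ^ c.length := by
  induction c with
  | nil => rfl
  | cons b c ih =>
    cases b with
    | false => simp at h
    | true =>
      have := ih (by simpa using h)
      rw [binVal, List.length_cons, pow_succ, Bool.toNat_true]
      omega

theorem binVal_binc (c : List Bool) : binVal (binc c) = binVal c + 1 := by
  induction c with
  | nil => rfl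
  | cons b c ih =>
    cases b with
    | false => simp [binc, binVal]; omega
    | true => simp [binc, binVal, ih]; omega

theorem binc_length {c : List Bool} (h : false ∈ c) : (binc c).length = c.length := by
  induction c with
  | nil => simp at h
  | cons b c ih =>
    cases b with
    | false => rfl
    | true => simpa [binc] using ih (by simpa using h)

theorem binVal_replicate_false (n : ℕ) : binVal (List.replicate n false) = 0 := by
  induction n with
  | zero => rfl
  | succ n ih => simp [List.replicate_succ, binVal, ih]

/-- A bound on the time of one trial, including the increment of the counter. -/
def trialTime (A m τ : ℕ) : ℕ := 8 * A + 6 * τ + 2 * m + 27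

/-- Here `r` is the number of trials left before the counter overflows. Every trial uses fresh
random bits and contributes the same factor. -/
theorem reach_loop (w : Word) (l : List Elt) (z : Turing.Tape (Sy N B))
    (tX : Bool → ℕ) (τ : ℕ) (hτ : ∀ t, tX t ≤ τ) (G : Bool → List Elt → Set Word)
    (hA : ∀ t x, x.Sublist l →
      (N true).Always O (trialInput B w l.length t x) (tX t) ({[Letter.bot]} ∪ G t x))
    (hG : ∀ t x, x.Sublist l → ∀ y ∈ G t x, y.head? ≠ some Letter.bot)
    (hyes : ∀ t x, x.Sublist l → ∀ y ∈ G t x, ∀ (o : OwnTapes N B) s v, 0 ≤ v →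
      R (conf (.inl .halt) {o with ans := tp [] [lt (.bit true)]} s) v)
    (hno : ∀ (o : OwnTapes N B) s, R (conf (.inl .halt) {o with ans := tp [] [lt (.bit false)]} s) 1)
    (hq : 0 ≤ trialFail N O B w l tX G) (r : ℕ) (c : List Bool)
    (hr : binVal c + r = 2 ^ c.length) :
    (machine N B d).Reach O R
      (r * trialTime (w.length + (listWord l).length + lam B l.length) c.length τ)
      (conf (.inl (.feedB true)) (main w l c z) fun _ => tp [] [])
      (trialFail N O B w l tX G ^ r) := by
  induction r generalizing c with
  | zero =>
    have := binVal_lt c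
    omega
  | succ r ih =>
    rw [pow_succ', Nat.succ_mul]
    by_cases hc : false ∈ c
    · have h1 := ih (binc c) (by rw [binVal_binc, binc_length hc]; omega)
      rw [binc_length hc] at h1
      refine (reach_trial w l c z tX τ hτ G hA hG hyes (pow_nonneg hq r)
        (reach_incC (main w l c z) _ [] c hc h1)).mono_time ?_
      simp only [trialTime, List.length_nil]
      omega
    · have h0 := binVal_of_false_notMem hc
      -- All bits are 1, so this is the last trial; the next increment overflows and the answer is
      -- `no`.
      obtain rfl : r = 0 := by omega
      refine (reach_trial w l c z tX τ hτ G hA hG hyes (pow_nonneg hq 0)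
        (reach_incC_overflow (T := 0) (main w l c z) _ [] c hc fun l' => .here ?_)).mono_time ?_
      · rw [pow_zero]
        exact hno {main w l c z with ctr := tp l' []} _
      · simp only [trialTime]
        omega

end Search

namespace Search

/-! ### The probability that a trial succeeds -/

theorem avg_le_one (t : Bool) (φ : List Elt → ℝ) (l : List Elt) (h : ∀ x, φ x ≤ 1) :
    avg t φ l ≤ 1 := by
  induction l generalizing φ with
  | nil => exact h []
  | cons e l ih =>
    have h1 := ih φ h
    have h2 := ih (fun x => φ (e :: x)) fun x => h _
    cases t <;> simp only [avg, if_true, Bool.false_eq_true, if_false] <;> linarith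

theorem avg_nonneg (t : Bool) (φ : List Elt → ℝ) (l : List Elt) (h : ∀ x, 0 ≤ φ x) :
    0 ≤ avg t φ l := by
  induction l generalizing φ with
  | nil => exact h []
  | cons e l ih =>
    have h1 := ih φ h
    have h2 := ih (fun x => φ (e :: x)) fun x => h _
    cases t <;> simp only [avg, if_true, Bool.false_eq_true, if_false] <;> linarith

/-- Each sublist has probability `1 / 2 ^ l.length`, and the favourable ones are the sublists of
size `a` inside `S`. The induction counts them by Pascal's rule: an element of `S` is either taken
or not, an element outside `S` must be skipped. -/
theorem avg_true_le (S : Finset Elt) {δ : ℝ} (φ : List Elt → ℝ) (l : List Elt)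
    (a : ℕ) (h : ∀ x, φ x ≤ 1)
    (hS : ∀ x, x.Sublist (l.filter (· ∈ S)) → x.length = a → φ x ≤ 1 - δ) :
    avg true φ l ≤ 1 - δ * (((l.filter (· ∈ S)).length.choose a : ℕ) : ℝ) / 2 ^ l.length := by
  induction l generalizing φ a with
  | nil =>
    cases a with
    | zero => simpa [avg] using hS [] (by simp) rfl
    | succ a => simpa [avg] using h []
  | cons e l ih =>
    simp only [avg, if_true]
    have h1 : avg true (fun x => φ (e :: x)) l ≤ 1 := avg_le_one _ _ _ fun x => h _
    have key : ∀ p q X Y D : ℝ, 0 < D → X ≤ 1 - p / D → Y ≤ 1 - q / D →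
        (X + Y) / 2 ≤ 1 - (p + q) / (D * 2) := by
      intro p q X Y D hD hX hY
      have : (p + q) / (D * 2) = (p / D + q / D) / 2 := by field_simp
      linarith
    by_cases he : e ∈ S
    · rw [List.filter_cons_of_pos (by simpa using he)] at hS ⊢
      have h2 := ih φ a h fun x hx => hS x (hx.cons e)
      rw [List.length_cons, List.length_cons, pow_succ]
      cases a with
      | zero =>
        have := key 0 _ _ _ _ (by positivity) (by simpa using h1) h2
        simpa using this
      | succ a =>
        have h3 := ih (fun x => φ (e :: x)) a (fun x => h _) fun x hx hxa =>
          hS _ (hx.cons_cons e) (by simp [hxa])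
        rw [Nat.choose_succ_succ, Nat.cast_add, mul_add]
        exact key _ _ _ _ _ (by positivity) h3 h2
    · rw [List.filter_cons_of_neg (by simpa using he)] at hS ⊢
      have h2 := ih φ a h hS
      rw [List.length_cons, pow_succ]
      have := key 0 _ _ _ _ (by positivity) (by simpa using h1) h2
      simpa using this

/-- Only one sublist is counted, the elements of `S`: each of them is taken with probability 1/4,
each other element skipped with probability 3/4. -/
theorem avg_false_le (S : Finset Elt) {δ : ℝ} (φ : List Elt → ℝ) (l : List Elt)
    (h : ∀ x, φ x ≤ 1) (hS : φ (l.filter (· ∈ S)) ≤ 1 - δ) :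
    avg false φ l ≤ 1 - δ * ((1 / 4) ^ (l.filter (· ∈ S)).length *
      (3 / 4) ^ (l.length - (l.filter (· ∈ S)).length)) := by
  induction l generalizing φ with
  | nil => simpa [avg] using hS
  | cons e l ih =>
    simp only [avg, Bool.false_eq_true, if_false]
    by_cases he : e ∈ S
    · rw [List.filter_cons_of_pos (by simpa using he)] at hS ⊢
      have h1 := ih (fun x => φ (e :: x)) (fun x => h _) hS
      have h2 := avg_le_one false φ l h
      rw [List.length_cons, List.length_cons, pow_succ, Nat.add_sub_add_right]
      nlinarith
    · rw [List.filter_cons_of_neg (by simpa using he)] at hS ⊢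
      have h1 := ih φ h hS
      have h2 := avg_le_one false (fun x => φ (e :: x)) l fun x => h _
      have h3 := l.length_filter_le (fun x => decide (x ∈ S))
      rw [List.length_cons, Nat.sub_add_comm h3, pow_succ]
      nlinarith

theorem length_filter_mem {l : List Elt} (hl : l.Nodup) {S : Finset Elt} (hS : S ⊆ l.toFinset) :
    (l.filter (· ∈ S)).length = S.card := by
  rw [← List.toFinset_card_of_nodup (hl.filter _)]
  congr 1
  ext e
  simpa using fun he => by simpa using hS he

variable {N : Bool → OracleMachine} {B : ℕ} {O : Set Word}

theorem trialFail_nonneg (w : Word) (l : List Elt) (tX : Bool → ℕ)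
    (G : Bool → List Elt → Set Word) : 0 ≤ trialFail N O B w l tX G :=
  div_nonneg (add_nonneg (avg_nonneg _ _ _ fun _ => failProb_nonneg _ _ _ _)
    (avg_nonneg _ _ _ fun _ => failProb_nonneg _ _ _ _)) zero_le_two

/-- The factor 4 is 2 for the choice of the right experiment and 2 for the error of the extension
algorithm; the other experiment is estimated trivially by 1. -/
theorem trialFail_le (w : Word) (l : List Elt) (tX : Bool → ℕ) (G : Bool → List Elt → Set Word)
    (hl : l.Nodup) (S : Finset Elt) (hS : S ⊆ l.toFinset)
    (htrue : ∀ x : List Elt, x.Nodup → x.toFinset ⊆ S → x.length + lam B l.length = S.card →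
      1 / 2 ≤ (N true).prob O (trialInput B w l.length true x) (tX true) (G true x))
    (hfalse : ∀ x : List Elt, x.Nodup → x.toFinset = S →
      1 / 2 ≤ (N true).prob O (trialInput B w l.length false x) (tX false) (G false x))
    {p : ℝ} (hp : lam B l.length ≤ S.card ∧
        p ≤ ((S.card.choose (lam B l.length) : ℕ) : ℝ) / 2 ^ l.length ∨
      p ≤ (1 / 4) ^ S.card * (3 / 4) ^ (l.length - S.card)) :
    trialFail N O B w l tX G ≤ 1 - p / 4 := by
  have h1 : ∀ t : Bool, avg t (fun x => failProb N O true (trialInput B w l.length t x) (tX t)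
      (G t x)) l ≤ 1 := fun t => avg_le_one _ _ _ fun _ => failProb_le_one _ _ _ _
  have hc := length_filter_mem hl hS
  rw [trialFail]
  rcases hp with ⟨hle, hp⟩ | hp
  · have h2 := avg_true_le S (δ := 1 / 2) (fun x => failProb N O true
      (trialInput B w l.length true x) (tX true) (G true x)) l (S.card - lam B l.length)
      (fun _ => failProb_le_one _ _ _ _) fun x hx hxa => by
        have := failProb_le_half true _ _ _ (htrue x ((hl.filter _).sublist hx)
          (fun e he => by simpa using (List.mem_filter.1 (hx.subset (List.mem_toFinset.1 he))).2)
          (by omega))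
        linarith
    rw [hc, Nat.choose_symm hle, mul_div_assoc] at h2
    linarith [h1 false]
  · have h2 := avg_false_le S (δ := 1 / 2) (fun x => failProb N O true
      (trialInput B w l.length false x) (tX false) (G false x)) l
      (fun _ => failProb_le_one _ _ _ _) (by
        have := failProb_le_half true _ _ _ (hfalse (l.filter (· ∈ S)) (hl.filter _) (by
          ext e
          simpa using fun he => by simpa using hS he))
        linarith)
    rw [hc] at h2
    linarith [h1 true]

/-- Independent repetition. -/
theorem pow_le_half {q : ℝ} (hq : 0 ≤ q) {a : ℕ} (h : q ≤ 1 - 1 / 2 ^ a) : q ^ 2 ^ a ≤ 1 / 2 := by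
  set p : ℝ := 1 / 2 ^ a with hp
  have hp0 : 0 < p := by positivity
  -- Since (1 - p)(1 + p) ≤ 1, Bernoulli's inequality can be applied to the powers of 1 + p.
  have h1 : q ≤ (1 + p)⁻¹ := by
    refine h.trans ?_
    rw [← one_div, le_div_iff₀ (by positivity)]
    nlinarith
  have h2 : 2 ≤ (1 + p) ^ 2 ^ a := by
    have := one_add_mul_le_pow (a := p) (by linarith) (2 ^ a)
    refine le_trans (le_of_eq ?_) this
    rw [hp]; push_cast; field_simp; norm_num
  calc q ^ 2 ^ a ≤ ((1 + p)⁻¹) ^ 2 ^ a := pow_le_pow_left₀ hq h1 _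
    _ = ((1 + p) ^ 2 ^ a)⁻¹ := inv_pow _ _
    _ ≤ 2⁻¹ := inv_anti₀ two_pos h2
    _ = 1 / 2 := by norm_num

end Search

namespace Search

/-! ### Numerical estimates -/

section Digits

variable {B : ℕ}

/-- The value of a list of digits. -/
def digVal : List (Fin (B + 2)) → ℕ
  | [] => 0
  | i :: c => i + (B + 2) * digVal c

theorem digVal_zinc (c : List (Fin (B + 2))) : digVal (zinc c) = digVal c + 1 := by
  induction c with
  | nil => simp [zinc, digVal]
  | cons i c ih =>
    by_cases hi : i.val + 1 < B + 2
    · simp only [zinc, hi, dif_pos, digVal]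
      omega
    · have := i.isLt
      simp only [zinc, hi, dif_neg, not_false_eq_true, digVal, ih, Fin.val_zero]
      rw [Nat.mul_succ]
      omega

theorem digVal_digits (n : ℕ) : digVal (digits B n) = n := by
  induction n with
  | zero => rfl
  | succ n ih => rw [digits_succ, digVal_zinc, ih]

theorem digVal_of_full {c : List (Fin (B + 2))} (h : Full c) :
    digVal c + 1 = (B + 2) ^ c.length := by
  induction c with
  | nil => rfl
  | cons i c ih =>
    have h1 := ih fun j hj => h j (by simp [hj])
    have h2 := h i (by simp)
    have := i.isLt
    have h3 : i.val = B + 1 := by omega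
    rw [digVal, h3, List.length_cons, pow_succ, ← h1]
    ring

theorem digVal_lt (c : List (Fin (B + 2))) : digVal c < (B + 2) ^ c.length := by
  induction c with
  | nil => simp [digVal]
  | cons i c ih =>
    have := i.isLt
    have h := Nat.mul_le_mul_left (B + 2) (Nat.succ_le_of_lt ih)
    rw [digVal, List.length_cons, pow_succ, mul_comm _ (B + 2)]
    rw [Nat.mul_succ] at h
    omega

theorem lt_pow_lam (n : ℕ) : n < (B + 2) ^ lam B n := by
  have := digVal_lt (digits B n)
  rwa [digVal_digits] at this

theorem pow_lam_le (n : ℕ) : (B + 2) ^ lam B (n + 1) ≤ (B + 2) * (n + 1) := by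
  induction n with
  | zero => simp [lam, digits, zinc]
  | succ n ih =>
    by_cases h : Full (digits B (n + 1))
    · rw [lam, digits_succ, zinc_length_of_full h, pow_succ, ← digVal_of_full h, digVal_digits]
      exact le_of_eq (mul_comm _ _)
    · rw [lam, digits_succ, zinc_length_of_not_full h]
      exact ih.trans (Nat.mul_le_mul_left _ (by omega))

/-- The digit count is defined by iterated increments, as the machine computes it; the two power
bounds identify it with a logarithm. -/
theorem lam_succ_eq (n : ℕ) : lam B (n + 1) = Nat.log (B + 2) (n + 1) + 1 := by
  have h1 := lt_pow_lam (B := B) (n + 1)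
  have h2 := pow_lam_le (B := B) n
  have h3 : 0 < lam B (n + 1) := by
    by_contra h
    rw [Nat.eq_zero_of_not_pos h, pow_zero] at h1
    omega
  obtain ⟨q, hq⟩ : ∃ q, lam B (n + 1) = q + 1 := ⟨lam B (n + 1) - 1, by omega⟩
  rw [hq] at h1 h2 ⊢
  rw [pow_succ, mul_comm] at h2
  rw [Nat.log_eq_of_pow_le_of_lt_pow (Nat.le_of_mul_le_mul_left h2 (by omega)) h1]

end Digits

/-- C(k, l) ≥ (k + 1 - l)^l / l!, and l! ≤ l^l. -/
theorem two_pow_le_choose {k l e : ℕ} (h : l * 2 ^ e + l ≤ k + 1) :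
    2 ^ (e * l) ≤ k.choose l := by
  refine Nat.le_of_mul_le_mul_left ?_ (Nat.factorial_pos l)
  calc l.factorial * 2 ^ (e * l) ≤ l ^ l * 2 ^ (e * l) :=
        Nat.mul_le_mul_right _ (Nat.factorial_le_pow l)
    _ = (l * 2 ^ e) ^ l := by rw [mul_pow, pow_mul]
    _ ≤ (k + 1 - l) ^ l := Nat.pow_le_pow_left (by omega) l
    _ ≤ k.descFactorial l := Nat.pow_sub_le_descFactorial k l
    _ = l.factorial * k.choose l := Nat.descFactorial_eq_factorial_mul_choose k l

/-- This is the purpose of the 4 in the base 2^(d+4): besides 2^(dq), the number n has a spare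
factor 16^q that absorbs all factors linear in the number of digits. -/
theorem eight_mul_add_four_le (q : ℕ) (hq : 1 ≤ q) : 8 * q + 4 ≤ 16 ^ q := by
  induction q, hq using Nat.le_induction with
  | base => norm_num
  | succ q hq ih => rw [pow_succ]; omega

/-- From 2^14 ≤ 3^9 one gets log 3 ≥ 14/9, and n - k ≥ 3n/4; the product 3/4 · 14/9 = 7/6 leaves n/6
for `s`. Twelfth powers clear the denominators. -/
theorem two_pow_le_three_pow {n k s : ℕ} (hs : 6 * s ≤ n) (hk : 4 * k ≤ n) :
    2 ^ (n + s) ≤ 3 ^ (n - k) := by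
  refine (Nat.pow_le_pow_iff_left (n := 12) (by norm_num)).1 ?_
  calc (2 ^ (n + s)) ^ 12 = 2 ^ ((n + s) * 12) := (pow_mul _ _ _).symm
    _ ≤ 2 ^ (14 * n) := Nat.pow_le_pow_right two_pos (by omega)
    _ = (2 ^ 14) ^ n := pow_mul _ _ _
    _ ≤ (3 ^ 9) ^ n := Nat.pow_le_pow_left (by norm_num) n
    _ = 3 ^ (9 * n) := (pow_mul _ _ _).symm
    _ ≤ 3 ^ ((n - k) * 12) := Nat.pow_le_pow_right (by norm_num) (by omega)
    _ = (3 ^ (n - k)) ^ 12 := pow_mul _ _ _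

theorem two_mul_choose_two (q : ℕ) : 2 * (q + 1).choose 2 = q * (q + 1) := by
  rw [Nat.choose_two_right, Nat.add_sub_cancel, mul_comm (q + 1), Nat.two_mul_div_two_of_even]
  exact Nat.even_mul_succ_self q

/-! ### Success probability against bits saved -/

section Saved

variable {B d : ℕ}

theorem saved_succ (n : ℕ) :
    2 * saved B d (n + 1) =
      d * (Nat.log (B + 2) (n + 1) * (Nat.log (B + 2) (n + 1) + 1)) := by
  rw [saved, lam_succ_eq, ← two_mul_choose_two]
  ring

theorem pow_le_of_log (hB : B + 2 = 2 ^ (d + 4)) (n : ℕ) :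
    2 ^ (d * Nat.log (B + 2) (n + 1)) * 16 ^ Nat.log (B + 2) (n + 1) ≤ n + 1 := by
  have h := Nat.pow_log_le_self (B + 2) (Nat.succ_ne_zero n)
  set q := Nat.log (B + 2) (n + 1)
  rw [hB, pow_add, mul_pow, ← pow_mul] at h
  exact h

theorem six_mul_saved_le (hB : B + 2 = 2 ^ (d + 4)) (n : ℕ) : 6 * saved B d n ≤ n := by
  cases n with
  | zero => simp [saved_zero]
  | succ n =>
    have h1 := saved_succ (B := B) (d := d) n
    have h2 := pow_le_of_log hB n
    set q := Nat.log (B + 2) (n + 1)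
    rcases Nat.eq_zero_or_pos q with hq | hq
    · rw [hq, zero_mul, mul_zero] at h1
      omega
    · have h3 := eight_mul_add_four_le q hq
      have h4 : d * q < 2 ^ (d * q) := Nat.lt_two_pow_self
      calc 6 * saved B d (n + 1) = 3 * (2 * saved B d (n + 1)) := by ring
        _ = (d * q) * (3 * (q + 1)) := by rw [h1]; ring
        _ ≤ 2 ^ (d * q) * 16 ^ q := Nat.mul_le_mul h4.le (by omega)
        _ ≤ n + 1 := h2

/-- The cases are divided at k = n/4. For large k and λ = q + 1, the base is chosen so that λ ·
2^(dq) + λ ≤ k + 1, whence C(k, λ) ≥ 2^(dq(q+1)); the saved bits are only half of this exponent. -/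
theorem two_pow_saved_le (hB : B + 2 = 2 ^ (d + 4)) {n k : ℕ} (hk : k ≤ n) :
    lam B n ≤ k ∧ 2 ^ saved B d n ≤ k.choose (lam B n) ∨
      2 ^ (n + saved B d n) ≤ 3 ^ (n - k) := by
  by_cases hkn : 4 * k < n
  · exact Or.inr (two_pow_le_three_pow (six_mul_saved_le hB n) hkn.le)
  refine Or.inl ?_
  cases n with
  | zero => simp [saved_zero, lam_zero]
  | succ n =>
    have h1 := saved_succ (B := B) (d := d) n
    have h2 := pow_le_of_log hB n
    rw [lam_succ_eq]
    set q := Nat.log (B + 2) (n + 1)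
    have key : (q + 1) * 2 ^ (d * q) + (q + 1) ≤ k + 1 := by
      rcases Nat.eq_zero_or_pos q with hq | hq
      · rw [hq]
        simp only [mul_zero, pow_zero]
        omega
      · have h3 := Nat.mul_le_mul_left (2 ^ (d * q)) (eight_mul_add_four_le q hq)
        have h4 : 1 ≤ 2 ^ (d * q) := Nat.one_le_two_pow
        have h5 := Nat.mul_le_mul_right q h4
        nlinarith
    have h6 : 1 ≤ 2 ^ (d * q) := Nat.one_le_two_pow
    refine ⟨by nlinarith, le_trans (Nat.pow_le_pow_right two_pos ?_)
      (two_pow_le_choose key)⟩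
    nlinarith

/-- The lower bound for the success probability of a trial, up to the factor `4`. -/
theorem success_le (hB : B + 2 = 2 ^ (d + 4)) {n k : ℕ} (hk : k ≤ n) :
    lam B n ≤ k ∧ (2 : ℝ) ^ saved B d n / 2 ^ n ≤ ((k.choose (lam B n) : ℕ) : ℝ) / 2 ^ n ∨
      (2 : ℝ) ^ saved B d n / 2 ^ n ≤ (1 / 4) ^ k * (3 / 4) ^ (n - k) := by
  refine (two_pow_saved_le (d := d) hB hk).imp (fun h => ⟨h.1, ?_⟩) fun h => ?_
  · have := h.2
    gcongr
    exact_mod_cast this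
  · have h' : (2 : ℝ) ^ (n + saved B d n) ≤ 3 ^ (n - k) := by exact_mod_cast h
    have e : (1 / 4 : ℝ) ^ k * (3 / 4) ^ (n - k) = 3 ^ (n - k) / 4 ^ n := by
      rw [div_pow, div_pow, one_pow, div_mul_div_comm, one_mul, ← pow_add, Nat.add_sub_cancel' hk]
    rw [e, show (4 : ℝ) = 2 * 2 by norm_num, mul_pow, div_le_div_iff₀ (by positivity)
      (by positivity)]
    rw [pow_add] at h'
    have := mul_le_mul_of_nonneg_right h' (pow_nonneg zero_le_two n (a := (2 : ℝ)))
    linarith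

end Saved

/-! ### Asymptotics -/

/-- With q the integer logarithm to base 2^D, log n ≤ D(q + 1) ≤ 2Dq once q ≥ 1. -/
theorem logSq_le {D n : ℕ} (hD : 0 < D) (hn : 2 ^ D ≤ n) :
    1 ≤ Nat.log (2 ^ D) n ∧
      1 / (4 * (D : ℝ) ^ 2) * logSq n ≤ (Nat.log (2 ^ D) n : ℝ) ^ 2 := by
  have hb : 1 < 2 ^ D := Nat.one_lt_two_pow hD.ne'
  have h1 : 1 ≤ Nat.log (2 ^ D) n := Nat.log_pos hb hn
  refine ⟨h1, ?_⟩
  set q := Nat.log (2 ^ D) n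
  have h2 : n < (2 ^ D) ^ (q + 1) := Nat.lt_pow_succ_log_self hb n
  have hn0 : (1 : ℝ) ≤ n := by exact_mod_cast (Nat.one_le_two_pow.trans hn)
  have h3 : Real.logb 2 n ≤ D * (q + 1) := by
    rw [Real.logb_le_iff_le_rpow one_lt_two (by linarith)]
    have : (n : ℝ) ≤ (2 ^ D) ^ (q + 1) := by exact_mod_cast h2.le
    rw [← pow_mul] at this
    exact_mod_cast this
  have h4 : 0 ≤ Real.logb 2 n := Real.logb_nonneg one_lt_two hn0
  have h5 : (1 : ℝ) ≤ q := by exact_mod_cast h1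
  have hD' : (0 : ℝ) < D := by exact_mod_cast hD
  have h6 : Real.logb 2 n ≤ 2 * D * q := by nlinarith
  have h7 : logSq n ≤ (2 * D * q) ^ 2 := pow_le_pow_left₀ h4 h6 2
  rw [one_div, inv_mul_le_iff₀ (by positivity)]
  linarith

theorem isOmega_of_log {f : ℕ → ℝ} {D : ℕ} (hD : 0 < D)
    (h : ∀ n, 2 ^ D ≤ n → (Nat.log (2 ^ D) n : ℝ) ^ 2 ≤ f n) : IsOmega f logSq := by
  have hD' : (0 : ℝ) < D := by exact_mod_cast hD
  refine ⟨1 / (4 * (D : ℝ) ^ 2), by positivity, ?_⟩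
  filter_upwards [Filter.eventually_ge_atTop (2 ^ D)] with n hn
  exact (logSq_le hD hn).2.trans (h n hn)

section ExpSq

variable {α : ℝ}

theorem expSq_le (α : ℝ) (l : ℕ) : (expSq α l : ℝ) ≤ 2 ^ (α * (l : ℝ) ^ 2) :=
  Nat.floor_le (Real.rpow_nonneg zero_le_two _)

theorem one_le_expSq (hα : 0 < α) (l : ℕ) : 1 ≤ expSq α l :=
  Nat.le_floor (by
    rw [Nat.cast_one]
    exact Real.one_le_rpow one_le_two (by positivity))

theorem expSq_zero : expSq α 0 = 1 := by simp [expSq]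

theorem logb_expSq_le (hα : 0 < α) (l : ℕ) : Real.logb 2 (expSq α l) ≤ α * (l : ℝ) ^ 2 := by
  rw [Real.logb_le_iff_le_rpow one_lt_two]
  · exact expSq_le α l
  · exact_mod_cast one_le_expSq hα l

theorem isOmega_Phi (hα : 0 < α) {D : ℕ} (hD : α + 4 ≤ D) : IsOmega (Phi (expSq α)) logSq := by
  have hD4 : 4 ≤ D := by
    have : (4 : ℝ) ≤ D := by linarith
    exact_mod_cast this
  refine isOmega_of_log (D := D) (by omega) fun n hn => ?_
  have h1 := (logSq_le (by omega) hn).1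
  have h2 := Nat.pow_log_le_self (2 ^ D) (x := n) (by have := Nat.one_le_two_pow.trans hn; omega)
  set q := Nat.log (2 ^ D) n
  have h3 : 4 * q ≤ n := by
    have h4 := eight_mul_add_four_le q h1
    have h5 : 16 ^ q ≤ (2 ^ D) ^ q :=
      Nat.pow_le_pow_left (show 2 ^ 4 ≤ 2 ^ D from Nat.pow_le_pow_right two_pos hD4) q
    omega
  -- The maximum is tested at ℓ = q. From 4q ≤ 2^(3q) the first term is at least (D - 3)q², and log
  -- g(q) ≤ αq², so D ≥ α + 4 leaves q².
  refine le_trans ?_ (Finset.le_sup' (fun ℓ : ℕ => (ℓ : ℝ) * Real.logb 2 ((n : ℝ) / (4 * (ℓ : ℝ))) -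
    Real.logb 2 (expSq α ℓ : ℝ)) (b := q) (Finset.mem_range.2 (by omega)))
  have hq : (1 : ℝ) ≤ q := by exact_mod_cast h1
  have h6 : ((D : ℝ) - 3) * q ≤ Real.logb 2 ((n : ℝ) / (4 * q)) := by
    rw [Real.le_logb_iff_rpow_le one_lt_two (by
      have : (0 : ℝ) < n := by exact_mod_cast (show 0 < n by omega)
      positivity), le_div_iff₀ (by positivity)]
    have e1 : (q : ℝ) ≤ 2 ^ q := by exact_mod_cast (Nat.lt_two_pow_self (n := q)).le
    have e2 : (4 : ℝ) ≤ 4 ^ q := by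
      have := pow_le_pow_right₀ (show (1 : ℝ) ≤ 4 by norm_num) h1
      simpa using this
    have e3 : (2 : ℝ) ^ (((D : ℝ) - 3) * q) = (2 ^ (D - 3)) ^ q := by
      rw [← pow_mul, ← Real.rpow_natCast]
      push_cast [show 3 ≤ D by omega]
      rfl
    rw [e3]
    calc ((2 : ℝ) ^ (D - 3)) ^ q * (4 * q) ≤ (2 ^ (D - 3)) ^ q * (4 ^ q * 2 ^ q) := by gcongr
      _ = (2 ^ D) ^ q := by
        rw [← mul_pow, ← mul_pow]
        congr 1
        rw [show (4 : ℝ) * 2 = 2 ^ 3 by norm_num, ← pow_add]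
        congr 1
        omega
      _ ≤ n := by exact_mod_cast h2
  have h7 := logb_expSq_le hα q
  have h8 := mul_le_mul_of_nonneg_left h6 (show (0 : ℝ) ≤ q by linarith)
  have h9 : 0 ≤ ((D : ℝ) - α - 4) * (q : ℝ) ^ 2 := mul_nonneg (by linarith) (sq_nonneg _)
  nlinarith

/-- The saving in the exponent of the running time. -/
noncomputable def saving (α : ℝ) (B d n : ℕ) : ℝ := saved B d n - α * (lam B n : ℝ) ^ 2

/-- With λ = q + 1, the saved bits are dq(q + 1)/2 ≥ (2α + 1)q(q + 1). For q ≥ 1 the loss α(q + 1)²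
is at most 2αq(q + 1), so at least q(q + 1) remains. -/
theorem isOmega_saving (hα : 0 < α) {B d : ℕ} (hd : 4 * α + 2 ≤ d) (hB : B + 2 = 2 ^ (d + 4)) :
    IsOmega (saving α B d) logSq := by
  refine isOmega_of_log (D := d + 4) (by omega) fun n hn => ?_
  have h1 := (logSq_le (by omega) hn).1
  obtain ⟨n, rfl⟩ : ∃ m, n = m + 1 := ⟨n - 1, by have := Nat.one_le_two_pow.trans hn; omega⟩
  have h2 := saved_succ (B := B) (d := d) n
  rw [saving, lam_succ_eq]
  rw [hB] at h2 ⊢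
  set q := Nat.log (2 ^ (d + 4)) (n + 1)
  have h3 : 2 * (saved B d (n + 1) : ℝ) = d * (q * (q + 1)) := by exact_mod_cast h2
  have hq : (1 : ℝ) ≤ q := by exact_mod_cast h1
  have h4 : (4 * α + 2) * ((q : ℝ) * (q + 1)) ≤ d * (q * (q + 1)) := by gcongr
  have h5 : 0 ≤ α * ((q : ℝ) - 1) * (q + 1) := by
    have : 0 ≤ (q : ℝ) - 1 := by linarith
    positivity
  push_cast
  nlinarith

end ExpSq

end Search

/-- The slack `u' - u` is added in both branches of every coin flip until it reaches the final
configurations. -/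
theorem OracleMachine.Reach.mono_value {M : OracleMachine} {O : Set Word}
    {R : M.Cfg → ℝ → Prop} (hR : ∀ c u u', R c u → u ≤ u' → R c u') {t : ℕ} {c : M.Cfg} {u u' : ℝ}
    (h : M.Reach O R t c u) (hu : u ≤ u') : M.Reach O R t c u' := by
  induction h generalizing u' with
  | here h => exact .here (hR _ _ _ h hu)
  | ask h1 h2 _ ih => exact .ask h1 h2 (ih hu)
  | @flip t c u u₁ u₀ h1 h2 _ _ h3 ih1 ih0 =>
    exact .flip h1 h2 (ih1 (u' := u₁ + (u' - u)) (by linarith))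
      (ih0 (u' := u₀ + (u' - u)) (by linarith)) (by rw [h3]; ring)

/-! ### Correctness of the search -/

namespace Search

variable {N : Bool → OracleMachine} {B d : ℕ}

theorem haltsIn_ans (o : OwnTapes N B) (s : Sub N → Turing.Tape (Sy N B)) (b : Bool) :
    (machine N B d).HaltsIn {[Letter.bit b]}
      (conf (.inl .halt) {o with ans := tp [] [lt (.bit b)]} s) := by
  refine ⟨rfl, _, rfl, ?_⟩
  change (∀ (i : ℕ) (h : i < [Letter.bit b].length), (tp ([] : List (Sy N B)) [lt (.bit b)]).nth i =
    lt [Letter.bit b][i]) ∧ (tp ([] : List (Sy N B)) [lt (.bit b)]).nth (1 : ℕ) = none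
  refine ⟨fun i h => ?_, by rw [tp_nth]; rfl⟩
  obtain rfl : i = 0 := by simpa using h
  rfl

/-- Hence the machine can tell ⊥ from an extension by looking at one cell. -/
theorem head_listWord (l : List Elt) : (listWord l).head? ≠ some Letter.bot := by
  cases l with
  | nil => simp [listWord]
  | cons e l =>
    rw [listWord_cons]
    cases e with
    | nil => simp [eltWord_nil]
    | cons b e => simp [eltWord_cons]

theorem length_le_listWord (l : List Elt) : l.length ≤ (listWord l).length := by
  induction l with
  | nil => simp
  | cons e l ih =>
    rw [listWord_cons, List.length_append, eltWord_length, List.length_cons]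
    omega

/-- The final configurations of the search: the answer `yes` is correct, and the value of the
answer `no` is at least `1`. -/
def Final (I : ImplicitSetInstance) (c : (machine N B d).Cfg) (v : ℝ) : Prop :=
  (machine N B d).HaltsIn {yesWord} c ∧ I.F.Nonempty ∧ 0 ≤ v ∨
    (machine N B d).HaltsIn {noWord} c ∧ 1 ≤ v

/-- The number of trials is `2 ^ width`. -/
theorem width_eq {n : ℕ} (h : saved B d n ≤ n) :
    (1 : ℝ) - 2 ^ saved B d n / 2 ^ n / 4 = 1 - 1 / 2 ^ width B d n := by
  have e : (2 : ℝ) ^ n * 4 = 2 ^ saved B d n * 2 ^ width B d n := by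
    rw [← pow_add, width, show saved B d n + (n + 2 - saved B d n) = n + 2 by omega, pow_add]
    norm_num
  rw [div_div, e, ← div_div, div_self (by positivity)]

/-- A bound on the running time of the search. -/
def searchTime (B d a t n τ : ℕ) : ℕ :=
  2 ^ width B d n * trialTime (a + (a + t + 1) + lam B n) (width B d n) τ +
    setupTime B d (a + t) n

section

variable (I : ImplicitSetInstance) {g : ℕ → ℕ} {tE tX : ℕ}

/-- The good outputs of the second subroutine. -/
def goodOutputs (x : List Elt) (ℓ : ℕ) : Set Word :=
  {u | ∃ S, IsSetWord u S ∧ I.IsExtension x.toFinset ℓ S}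

/-- The number `u` bounds the probability of the answer `no`. The time bound does not depend on `u`,
so different values of `u` may be used for the same run. -/
theorem reach_search (hB : B + 2 = 2 ^ (d + 4))
    (hE : (N false).Always I.queryYes (bitsWord I.B) tE {u | IsSetWord u I.E})
    (hX : ∀ x : List Elt, x.Nodup → x.toFinset ⊆ I.E → ∀ ℓ,
      (N true).Always I.queryYes (query (bitsWord I.B) (listWord x) (natWord ℓ)) (g ℓ * tX)
        ({[Letter.bot]} ∪ goodOutputs I x ℓ) ∧
      ((∃ S, I.IsExtension x.toFinset ℓ S) → 1 / 2 ≤ (N true).prob I.queryYes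
        (query (bitsWord I.B) (listWord x) (natWord ℓ)) (g ℓ * tX) (goodOutputs I x ℓ)))
    (u : ℝ) (hu : 0 ≤ u) (hF : I.F.Nonempty → 1 / 2 ≤ u) (hF' : I.F = ∅ → 1 ≤ u) :
    (machine N B d).Reach I.queryYes (Final I)
      (searchTime B d I.B.length tE I.E.card ((g (lam B I.E.card) + g 0) * tX))
      ((machine N B d).init (bitsWord I.B)) u := by
  have hmono : ∀ (c : (machine N B d).Cfg) (u u' : ℝ), Final I c u → u ≤ u' → Final I c u' :=
    fun c u u' h h' => h.imp (fun h => ⟨h.1, h.2.1, h.2.2.trans h'⟩) fun h => ⟨h.1, h.2.trans h'⟩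
  have hs : saved B d I.E.card ≤ I.E.card := by
    have := six_mul_saved_le (d := d) hB I.E.card
    omega
  have hw : (bitsWord I.B).length = I.B.length := List.length_map _
  rw [searchTime, ← hw]
  refine reach_setup (bitsWord I.B) tE I.E hE hs hu fun l hl hlE hlen => ?_
  have hc : l.length = I.E.card := by rw [← hlE, List.toFinset_card_of_nodup hl]
  rw [← hc] at hs ⊢
  let m : Bool → ℕ := fun t => if t then lam B l.length else 0
  have hin : ∀ t x, trialInput B (bitsWord I.B) l.length t x =
      query (bitsWord I.B) (listWord x) (natWord (m t)) := by
    rintro (_ | _) x <;> rfl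
  let G : Bool → List Elt → Set Word := fun t x => goodOutputs I x (m t)
  have hsub : ∀ x : List Elt, x.Sublist l → x.Nodup ∧ x.toFinset ⊆ I.E := fun x hx =>
    ⟨hl.sublist hx, hlE ▸ fun e he => List.mem_toFinset.2 (hx.subset (List.mem_toFinset.1 he))⟩
  have h1 := reach_loop (R := Final I) (d := d) (O := I.queryYes) (bitsWord I.B) l
    (tp [] (digs (digits B l.length))) (fun t => g (m t) * tX)
    ((g (lam B l.length) + g 0) * tX)
    (by rintro (_ | _) <;> exact Nat.mul_le_mul_right _ (by simp [m])) G
    (fun t x hx => by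
      rw [hin]
      exact (hX x (hsub x hx).1 (hsub x hx).2 (m t)).1)
    (by
      rintro t x hx y ⟨S, ⟨l', -, -, rfl⟩, -⟩
      exact head_listWord l')
    (by
      rintro t x hx y ⟨S, -, hS⟩ o s v hv
      exact Or.inl ⟨haltsIn_ans o s true, ⟨_, hS.2.1⟩, hv⟩)
    (fun o s => Or.inr ⟨haltsIn_ans o s false, le_rfl⟩)
    (trialFail_nonneg _ _ _ _) (2 ^ width B d l.length)
    (List.replicate (width B d l.length) false) (by
      rw [binVal_replicate_false, List.length_replicate, zero_add])
  refine (h1.mono_value hmono ?_).mono_time ?_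
  · rcases I.F.eq_empty_or_nonempty with h | ⟨S, hS⟩
    · refine le_trans (pow_le_one₀ (trialFail_nonneg _ _ _ _) ?_) (hF' h)
      have := avg_le_one true (fun x => failProb N I.queryYes true
        (trialInput B (bitsWord I.B) l.length true x) (g (m true) * tX) (G true x)) l
        fun _ => failProb_le_one _ _ _ _
      have := avg_le_one false (fun x => failProb N I.queryYes true
        (trialInput B (bitsWord I.B) l.length false x) (g (m false) * tX) (G false x)) l
        fun _ => failProb_le_one _ _ _ _
      rw [trialFail]
      linarith
    · refine le_trans (pow_le_half (trialFail_nonneg _ _ _ _) ?_) (hF ⟨S, hS⟩)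
      rw [← width_eq hs]
      have hSE : S ⊆ l.toFinset := hlE ▸ I.F_subset S hS
      have hSc : S.card ≤ l.length := (Finset.card_le_card hSE).trans (List.toFinset_card_le l)
      refine trialFail_le _ _ _ _ hl S hSE (fun x hx hxS hxl => ?_) (fun x hx hxS => ?_)
        (success_le hB hSc)
      · rw [hin]
        -- A sample inside `S` that misses exactly λ of its elements is extended by the missing
        -- ones.
        refine (hX x hx (hxS.trans (I.F_subset S hS)) (m true)).2 ⟨S \ x.toFinset,
          Finset.sdiff_subset_sdiff (I.F_subset S hS) le_rfl, ?_, ?_⟩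
        · rwa [Finset.union_sdiff_of_subset hxS]
        · rw [Finset.card_sdiff_of_subset hxS, List.toFinset_card_of_nodup hx]
          simp only [m, if_true]
          omega
      · rw [hin]
        refine (hX x hx (hxS.trans_subset (I.F_subset S hS)) (m false)).2 ⟨∅, by simp, ?_, rfl⟩
        rwa [Finset.union_empty, hxS]
  · refine Nat.mul_le_mul_left _ ?_
    rw [List.length_replicate, trialTime, trialTime]
    omega

theorem isRandomizedAlgorithm_of_reach {P : Set ImplicitSetInstance}
    {τ : ImplicitSetInstance → ℝ}
    (h : ∀ I ∈ P, ∃ T : ℕ, (T : ℝ) ≤ τ I ∧ ∀ u : ℝ, 0 ≤ u → (I.F.Nonempty → 1 / 2 ≤ u) →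
      (I.F = ∅ → 1 ≤ u) → (machine N B d).Reach I.queryYes (Final I) T
        ((machine N B d).init (bitsWord I.B)) u) :
    IsRandomizedAlgorithm (machine N B d) P τ := by
  intro I hI
  obtain ⟨T, hT, h⟩ := h I hI
  have hhalt : ∀ (c : (machine N B d).Cfg) (u : ℝ), Final I c u →
      c.state = (machine N B d).halt := by
    rintro c u (⟨h, -⟩ | ⟨h, -⟩) <;> exact h.1
  -- The value 1 is admissible for every instance; it gives all statements about the possible
  -- outcomes. The value 1/2 is used below for the probability.
  have hsupp := (h 1 zero_le_one (fun _ => by norm_num) fun _ => le_rfl).support hhalt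
  refine ⟨T, hT, fun c hc => ?_, fun hF => ?_, fun hF c hc => ?_⟩
  · obtain ⟨v, ⟨hv, -⟩ | ⟨hv, -⟩⟩ := hsupp c hc
    · exact ⟨hv.1, hv.2.imp fun _ h => ⟨Or.inl h.1, h.2⟩⟩
    · exact ⟨hv.1, hv.2.imp fun _ h => ⟨Or.inr h.1, h.2⟩⟩
  · have h1 := (h (1 / 2) (by norm_num) (fun _ => le_rfl) fun h => by simp [h] at hF).measure_le
      hhalt (A := {c | (machine N B d).HaltsIn {yesWord} c}ᶜ)
      (by rintro c u (⟨-, -, h⟩ | ⟨-, h⟩); exacts [h, zero_le_one.trans h])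
      (by rintro c u (⟨h, -⟩ | ⟨-, h⟩) hc; exacts [absurd h hc, h])
    have h2 := toOuterMeasure_add_compl ((machine N B d).run I.queryYes T
      ((machine N B d).init (bitsWord I.B))) {c | (machine N B d).HaltsIn {yesWord} c}
    have h3 : ENNReal.ofReal (1 / 2) = 1 / 2 := by
      rw [ENNReal.ofReal_div_of_pos two_pos, ENNReal.ofReal_one, ENNReal.ofReal_ofNat]
    have h4 := h1.2
    rw [h3] at h4
    unfold OracleMachine.prob
    by_contra hlt
    push Not at hlt
    have h5 := ENNReal.add_lt_add_of_lt_of_le (ne_top_of_le_ne_top (by simp) h4) hlt h4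
    rw [h2, ENNReal.add_halves] at h5
    exact lt_irrefl _ h5
  · obtain ⟨v, ⟨-, hv, -⟩ | ⟨hv, -⟩⟩ := hsupp c hc
    · simp [hF] at hv
    · exact hv

end

/-! ### The running time -/

/-- The polynomial factor of the running time. -/
noncomputable def timePoly (d : ℕ) (pE pX : Polynomial ℕ) : Polynomial ℕ :=
  let q := Polynomial.X + pE + 1
  13 * q + q * ((d + 4 : ℕ) * q + 6) + 27 + 4 * (26 * q + 31 + 12 * pX)

theorem lam_le (n : ℕ) : lam B n ≤ n := by
  induction n with
  | zero => rfl
  | succ n ih =>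
    rw [lam, digits_succ]
    by_cases h : Full (digits B n)
    · rw [zinc_length_of_full h]; exact Nat.succ_le_succ ih
    · rw [zinc_length_of_not_full h]; exact ih.trans n.le_succ

/-- Since both `G` and the power of 2 are at least 1, additive terms can be absorbed into the
product; the factor 4 comes from the two extra bits of the counter. -/
theorem searchTime_le (hB : B + 2 = 2 ^ (d + 4)) (pE pX : Polynomial ℕ) (a n G : ℕ) (hG : 1 ≤ G)
    (hn : n ≤ a + pE.eval a + 1) :
    searchTime B d a (pE.eval a) n ((G + 1) * pX.eval a) ≤
      2 ^ (n - saved B d n) * G * (timePoly d pE pX).eval a := by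
  have hs : saved B d n ≤ n := by
    have := six_mul_saved_le (d := d) hB n
    omega
  have hw : width B d n ≤ a + pE.eval a + 1 + 2 := by rw [width]; omega
  have hw' : 2 ^ width B d n = 2 ^ (n - saved B d n) * 4 := by
    rw [width, show n + 2 - saved B d n = n - saved B d n + 2 by omega, pow_add]
    norm_num
  have hl : lam B n ≤ a + pE.eval a + 1 := (lam_le n).trans hn
  have e : (timePoly d pE pX).eval a = 13 * (a + pE.eval a + 1) + (a + pE.eval a + 1) *
      ((d + 4) * (a + pE.eval a + 1) + 6) + 27 +
      4 * (26 * (a + pE.eval a + 1) + 31 + 12 * pX.eval a) := by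
    simp [timePoly]
  rw [e, searchTime, hw']
  set Q := a + pE.eval a + 1 with hQ
  set x := pX.eval a
  have hpow : 1 ≤ 2 ^ (n - saved B d n) := Nat.one_le_two_pow
  have h1 : setupTime B d (a + pE.eval a) n ≤ 13 * Q + Q * ((d + 4) * Q + 6) + 27 := by
    rw [setupTime]
    have : n * ((d + 4) * lam B n + 6) ≤ Q * ((d + 4) * Q + 6) := by gcongr
    omega
  have h2 : trialTime (a + Q + lam B n) (width B d n) ((G + 1) * x) ≤
      G * (26 * Q + 31 + 12 * x) := by
    have h3 : (G + 1) * x ≤ 2 * (G * x) := by nlinarith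
    have h4 : 26 * Q + 31 ≤ G * (26 * Q + 31) := Nat.le_mul_of_pos_left _ hG
    have h5 : G * (26 * Q + 31 + 12 * x) = G * (26 * Q + 31) + 12 * (G * x) := by ring
    rw [trialTime, h5]
    omega
  calc _ ≤ 2 ^ (n - saved B d n) * 4 * (G * (26 * Q + 31 + 12 * x)) +
        (13 * Q + Q * ((d + 4) * Q + 6) + 27) := by gcongr
    _ ≤ 2 ^ (n - saved B d n) * 4 * (G * (26 * Q + 31 + 12 * x)) +
        2 ^ (n - saved B d n) * G * (13 * Q + Q * ((d + 4) * Q + 6) + 27) := by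
      gcongr
      exact Nat.le_mul_of_pos_left _ (Nat.mul_pos hpow hG)
    _ = _ := by ring

theorem two_rpow_saving {α : ℝ} {n : ℕ} (hs : saved B d n ≤ n) :
    (2 : ℝ) ^ (n - saved B d n) * expSq α (lam B n) ≤ 2 ^ ((n : ℝ) - saving α B d n) := by
  have e : (2 : ℝ) ^ ((n : ℝ) - saving α B d n) =
      2 ^ (n - saved B d n) * 2 ^ (α * (lam B n : ℝ) ^ 2) := by
    rw [← Real.rpow_natCast 2 (n - saved B d n), ← Real.rpow_add two_pos, saving,
      Nat.cast_sub hs]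
    congr 1
    ring
  rw [e]
  gcongr
  exact expSq_le α _

/-- A derivation of `Reach` is a finite tree and has a leaf, so facts learnt along a run can be
extracted from it. -/
theorem of_reach_const {M : OracleMachine} {O : Set Word} {p : Prop} {t : ℕ} {c : M.Cfg} {u : ℝ}
    (h : M.Reach O (fun _ _ => p) t c u) : p := by
  induction h with
  | here h => exact h
  | ask _ _ _ ih => exact ih
  | flip _ _ _ _ _ ih _ => exact ih

/-- The ground set is written out in time `t`, so it is small. This is read off from the setup phase
of the search machine with `d = 0`, where no bits are saved and the side condition is trivial. -/
theorem card_le_of_always {O : Set Word} {w : Word} {t : ℕ} {E : Finset Elt}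
    (h : (N false).Always O w t {u | IsSetWord u E}) : E.card ≤ w.length + t + 1 := by
  refine of_reach_const (reach_setup (B := 0) (d := 0) (T := 0) (u := 0) w t E h (by simp [saved])
    le_rfl fun l hl hlE hlen => .here ?_)
  rw [← hlE, List.toFinset_card_of_nodup hl]
  exact (length_le_listWord l).trans hlen

end Search

/-! ### The main theorem -/

theorem mainTheorem8 (α : ℝ) (hα : 0 < α) :
    IsOmega (Phi (expSq α)) logSq ∧
    ∃ f : ℕ → ℝ, IsOmega f logSq ∧
      ∀ P : Set ImplicitSetInstance, PolyTimeComputable P →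
        (∃ M : OracleMachine, IsExtensionAlgorithm M P (expSq α)) →
        ∃ (M : OracleMachine) (p : Polynomial ℕ),
          IsRandomizedAlgorithm M P (fun I =>
            (2 : ℝ) ^ ((I.E.card : ℝ) - f I.E.card) * ((p.eval I.B.length : ℕ) : ℝ)) := by
  -- This choice suits both claims: the saving needs d ≥ 4α + 2, and the bound for Φ needs d + 4 ≥ α
  -- + 4.
  obtain ⟨d, hd⟩ := exists_nat_ge (4 * α + 2)
  obtain ⟨B, hB⟩ : ∃ B, B + 2 = 2 ^ (d + 4) :=
    ⟨2 ^ (d + 4) - 2, Nat.sub_add_cancel (Nat.pow_le_pow_right two_pos (show 1 ≤ d + 4 by omega))⟩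
  refine ⟨Search.isOmega_Phi hα (D := d + 4) (by push_cast; linarith), Search.saving α B d,
    Search.isOmega_saving hα hd hB, ?_⟩
  rintro P ⟨⟨M₀, -, pE, hE⟩, -⟩ ⟨M₁, pX, hX⟩
  let N : Bool → OracleMachine := fun k => match k with
    | false => M₀
    | true => M₁
  refine ⟨Search.machine N B d, Search.timePoly d pE pX,
    Search.isRandomizedAlgorithm_of_reach fun I hI => ⟨_, ?_, Search.reach_search (N := N) I hB
      (hE I hI) (g := expSq α) (tX := pX.eval I.B.length) fun x hx hxE ℓ =>
        hX I hI x.toFinset hxE (listWord x) ⟨x, hx, rfl, rfl⟩ ℓ⟩⟩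
  have hn : I.E.card ≤ I.B.length + pE.eval I.B.length + 1 := by
    have := Search.card_le_of_always (N := N) (hE I hI)
    rwa [bitsWord, List.length_map] at this
  have hs : Search.saved B d I.E.card ≤ I.E.card := by
    have := Search.six_mul_saved_le (d := d) hB I.E.card
    omega
  rw [Search.expSq_zero]
  have h1 := Search.searchTime_le hB pE pX I.B.length I.E.card _
    (Search.one_le_expSq hα (Search.lam B I.E.card)) hn
  refine le_trans (Nat.cast_le.2 h1) ?_
  push_cast
  gcongr
  exact Search.two_rpow_saving hs
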